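/- **Setting.** Let $(\mathcal X,d)$ be a connected compact metric space of infinite cardinality with a finite, strictly positive Borel measure $\nu$, and write $L_2=L_2(\mathcal X,\nu)$. Let $\mu=\mathsf N(m,\mathcal C)$ and $\widetilde\mu=\mathsf N(\widetilde m,\widetilde{\mathcal C})$ be the Gaussian measures of two Gaussian processes $Z$ on $(\Omega,\mathbb P)$ and $\widetilde Z$ on $(\widetilde\Omega,\widetilde{\mathbb P})$, indexed by $\mathcal X$, with mean functions $m,\widetilde m\in L_2$ and continuous, strictly positive definite covariance functions $\varrho,\widetilde\varrho$, whose covariance operators $(\mathcal Cw)(x)=\int\varrho(x,x')w(x')\,d\nu(x')$ and $\widetilde{\mathcal C}$ (defined likewise) are positive definite on $L_2$, i.e. $(\mathcal Cw,w)_{L_2}>0$ and $(\widetilde{\mathcal C}w,w)_{L_2}>0$ for $w\ne0$. Let $Z^0=Z-m$, $\widetilde Z^0=\widetilde Z-\widetilde m$, let $\mathcal H^0$ be the closed linear span of $\{Z^0(x)\}_{x\in\mathcal X}$ in $L_2(\Omega,\mathbb P)$, and $\mathcal H=\mathbb R\oplus\mathcal H^0$. Let $\mathcal S_{\rm adm}^\mu$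 be the set of sequences $\{\mathcal H_n\}$ with $\mathcal H_n=\mathbb R\oplus\mathcal H_n^0$, $\mathcal H^0_n\subset\mathcal H^0$, $\dim\mathcal H_n^0=n$, such that for all $h\in\mathcal H$ the best linear predictors $h_n$ (the $L_2(\Omega,\mathbb P)$-orthogonal projections of $h$ onto $\mathcal H_n$) satisfy $\mathsf E[(h_n-h)^2]\to0$. *The second model.* Let $\mathcal K\subset L_2(\Omega,\mathbb P)\times L_2(\widetilde\Omega,\widetilde{\mathbb P})$ be the closure of the set of pairs $\bigl(\sum_j\alpha_jZ^0(x_j),\sum_j\alpha_j\widetilde Z^0(x_j)\bigr)$ (finite sums). The models are *compatible* if for all $(k,\widetilde k)\in\mathcal K$: $k=0\iff\widetilde k=0$. An element $h\in\mathcal H$ is *common* if $(h-\mathsf E[h],\widetilde k)\in\mathcal K$ for some $\widetilde k$; then $\widetilde{\mathsf{Var}}[h]:=\|\widetilde k\|^2_{L_2(\widetilde{\mathbb P})}$, which for compatible models does not depend on the choice of $\widetilde k$. For common $h$ and a finite-dimensional $\mathcal H_n$ of common elements, $\widetilde h_n\in\mathcal H_n$ denotes a minimizer of $g\mapsto\widetilde{\mathsf{Var}}[g-h]$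 over $\mathcal H_n$, i.e. the best linear predictor based on $\mathcal H_n$ and $\widetilde\mu$; for compatible models it is unique up to an additive constant, which affects no variance. Let $\mathcal H_{-n}$ be the set of common $h\in\mathcal H$ with $\mathsf E[(h_n-h)^2]>0$. *Assumptions.* (I) The Cameron–Martin spaces $\mathcal C^{1/2}(L_2)$ and $\widetilde{\mathcal C}^{1/2}(L_2)$, with norms $\|\mathcal C^{-1/2}\cdot\|_{L_2}$ and $\|\widetilde{\mathcal C}^{-1/2}\cdot\|_{L_2}$, coincide as sets and have equivalent norms. (III$_a$), for $a\in(0,\infty)$: $T_a=\mathcal C^{-1/2}\widetilde{\mathcal C}\mathcal C^{-1/2}-a\mathcal I$ is a compact operator on $L_2$. (III) means that (III$_a$) holds for some $a\in(0,\infty)$. *Assertions.* For $a\in(0,\infty)$ consider $$(1)\ \lim_{n\to\infty}\sup_{h\in\mathcal H_{-n}}\frac{\mathsf{Var}[\widetilde h_n-h]}{\mathsf{Var}[h_n-h]}=1,\qquad(2)\ \lim_{n\to\infty}\sup_{h\in\mathcal H_{-n}}\frac{\widetilde{\mathsf{Var}}[h_n-h]}{\widetilde{\mathsf{Var}}[\widetilde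 h_n-h]}=1,$$ $$(3)_a\ \lim_{n\to\infty}\sup_{h\in\mathcal H_{-n}}\left|\frac{\widetilde{\mathsf{Var}}[h_n-h]}{\mathsf{Var}[h_n-h]}-a\right|=0,\qquad(4)_a\ \lim_{n\to\infty}\sup_{h\in\mathcal H_{-n}}\left|\frac{\mathsf{Var}[\widetilde h_n-h]}{\widetilde{\mathsf{Var}}[\widetilde h_n-h]}-\frac1a\right|=0.$$ We say that one of them *holds for all admissible sequences* if the models are compatible and it holds for every $\{\mathcal H_n\}\in\mathcal S^\mu_{\rm adm}$ consisting of subspaces of common elements. **Theorem.** If (I) holds, then the models are compatible and every $h\in\mathcal H$ is common (so that the assertions concern all of $\mathcal S^\mu_{\rm adm}$ and all $h\in\mathcal H$ with $\mathsf E[(h_n-h)^2]>0$). Moreover: * (1) holds for all admissible sequences if and only if (I) and (III) hold; * (2) holds for all admissible sequences if and only if (I) and (III) hold; * for every $a\in(0,\infty)$, $(3)_a$ holds for all admissible sequences if and only if (I) and (III$_a$) hold; * for every $a\in(0,\infty)$, $(4)_a$ holds for all admissible sequences if and only if (I) and (III$_a$) hold. -/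

import Mathlib

open MeasureTheory ProbabilityTheory Filter Topology
open scoped ENNReal InnerProductSpace

namespace Kriging

section Operators

variable {X : Type*} [MetricSpace X] [CompactSpace X] [MeasurableSpace X] [BorelSpace X]

/-- The function `x ↦ ∫ ρ(x, x') w(x') dν(x')`. -/
noncomputable def kernelFun (ν : Measure X) (ρ : C(X × X, ℝ)) (w : Lp ℝ 2 ν) (x : X) : ℝ :=
  ∫ x', ρ (x, x') * w x' ∂ν

variable {ν : Measure X} [IsFiniteMeasure ν]

lemma integrable_coe (w : Lp ℝ 2 ν) : Integrable (fun x => w x) ν :=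
  (Lp.memLp w).integrable (by norm_num)

lemma integrable_kernel_mul (ρ : C(X × X, ℝ)) (w : Lp ℝ 2 ν) (x : X) :
    Integrable (fun x' => ρ (x, x') * w x') ν := by
  refine (integrable_coe w).bdd_mul (c := ‖ρ‖) ?_ (Eventually.of_forall fun x' => ?_)
  · exact (Continuous.measurable (by fun_prop)).aestronglyMeasurable
  · exact ρ.norm_coe_le_norm (x, x')

lemma continuous_kernelFun (ρ : C(X × X, ℝ)) (w : Lp ℝ 2 ν) :
    Continuous (kernelFun ν ρ w) := by
  unfold kernelFun
  refine continuous_of_dominated (bound := fun x' => ‖ρ‖ * ‖w x'‖)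
    (fun x => (integrable_kernel_mul ρ w x).aestronglyMeasurable)
    (fun x => Eventually.of_forall fun x' => ?_) ((integrable_coe w).norm.const_mul _)
    (Eventually.of_forall fun x' => by fun_prop)
  rw [norm_mul]
  exact mul_le_mul_of_nonneg_right (ρ.norm_coe_le_norm _) (norm_nonneg _)

lemma norm_kernelFun_le (ρ : C(X × X, ℝ)) (w : Lp ℝ 2 ν) (x : X) :
    ‖kernelFun ν ρ w x‖ ≤ ‖ρ‖ * ∫ x', ‖w x'‖ ∂ν := by
  unfold kernelFun
  rw [← integral_const_mul]
  refine norm_integral_le_of_norm_le ((integrable_coe w).norm.const_mul _)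
    (Eventually.of_forall fun x' => ?_)
  rw [norm_mul]
  exact mul_le_mul_of_nonneg_right (ρ.norm_coe_le_norm _) (norm_nonneg _)

lemma integral_norm_le (w : Lp ℝ 2 ν) :
    ∫ x', ‖w x'‖ ∂ν ≤ ‖w‖ * (ν Set.univ ^ (1 / (2 : ℝ))).toReal := by
  have h := eLpNorm_le_eLpNorm_mul_rpow_measure_univ (μ := ν) (p := 1) (q := 2)
    (by norm_num) (Lp.memLp w).aestronglyMeasurable
  have h1 : (1 / (1 : ℝ≥0∞).toReal - 1 / (2 : ℝ≥0∞).toReal) = 1 / (2 : ℝ) := by norm_num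
  rw [h1] at h
  have h2 : ∫ x', ‖w x'‖ ∂ν = (eLpNorm w 1 ν).toReal := by
    rw [integral_norm_eq_lintegral_enorm (Lp.memLp w).aestronglyMeasurable,
      eLpNorm_one_eq_lintegral_enorm]
  rw [h2, Lp.norm_def, ← ENNReal.toReal_mul]
  refine ENNReal.toReal_mono (ENNReal.mul_ne_top (Lp.eLpNorm_ne_top w) ?_) h
  exact ENNReal.rpow_ne_top_of_nonneg (by norm_num) (measure_ne_top ν _)

lemma memLp_kernelFun (ρ : C(X × X, ℝ)) (w : Lp ℝ 2 ν) : MemLp (kernelFun ν ρ w) 2 ν :=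
  MemLp.of_bound (continuous_kernelFun ρ w).measurable.aestronglyMeasurable _
    (Eventually.of_forall (norm_kernelFun_le ρ w))

/-- The covariance operator `(C w)(x) = ∫ ρ(x, x') w(x') dν(x')` on `L₂(X, ν)`. -/
noncomputable def covOp (ν : Measure X) [IsFiniteMeasure ν] (ρ : C(X × X, ℝ)) :
    Lp ℝ 2 ν →L[ℝ] Lp ℝ 2 ν :=
  LinearMap.mkContinuousOfExistsBound
    { toFun := fun w => (memLp_kernelFun ρ w).toLp
      map_add' := fun w w' => by
        rw [← MemLp.toLp_add]
        congr 1
        funext x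
        simp only [Pi.add_apply, kernelFun]
        rw [← integral_add (integrable_kernel_mul ρ w x) (integrable_kernel_mul ρ w' x)]
        refine integral_congr_ae ?_
        filter_upwards [Lp.coeFn_add w w'] with x' hx'
        rw [hx', Pi.add_apply, mul_add]
      map_smul' := fun c w => by
        rw [RingHom.id_apply, ← MemLp.toLp_const_smul]
        congr 1
        funext x
        simp only [Pi.smul_apply, kernelFun, smul_eq_mul]
        rw [← integral_const_mul]
        refine integral_congr_ae ?_
        filter_upwards [Lp.coeFn_smul c w] with x' hx'
        rw [hx', Pi.smul_apply, smul_eq_mul]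
        ring }
    (by
      refine ⟨(measureUnivNNReal ν : ℝ) ^ (2 : ℝ≥0∞).toReal⁻¹ *
        (‖ρ‖ * (ν Set.univ ^ (1 / (2 : ℝ))).toReal), fun w => ?_⟩
      have hb : ∀ᵐ x ∂ν, ‖((memLp_kernelFun ρ w).toLp : Lp ℝ 2 ν) x‖ ≤
          ‖ρ‖ * ∫ x', ‖w x'‖ ∂ν := by
        filter_upwards [(memLp_kernelFun ρ w).coeFn_toLp] with x hx
        rw [hx]
        exact norm_kernelFun_le ρ w x
      have h0 : 0 ≤ ‖ρ‖ * ∫ x', ‖w x'‖ ∂ν :=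
        mul_nonneg (norm_nonneg _) (integral_nonneg fun _ => norm_nonneg _)
      refine (Lp.norm_le_of_ae_bound h0 hb).trans ?_
      rw [mul_assoc, mul_assoc, mul_comm _ ‖w‖]
      gcongr
      exact integral_norm_le w)

/-- The square root of a positive bounded operator on a Hilbert space: the (unique) positive
bounded operator whose square it is. -/
noncomputable def opSqrt {E : Type*} [NormedAddCommGroup E] [InnerProductSpace ℝ E]
    (A : E →L[ℝ] E) : E →L[ℝ] E :=
  Classical.epsilon fun S : E →L[ℝ] E => S.IsPositive ∧ S ∘L S = A

end Operators

section Models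

variable {X : Type*} [MetricSpace X] [CompactSpace X] [MeasurableSpace X] [BorelSpace X]

/-- A Gaussian process `Z` on `X` with mean value function in `L₂(X, ν)` and with continuous,
strictly positive definite covariance function whose covariance operator on `L₂(X, ν)` is positive
definite. It realizes the Gaussian measure `N(m, C)`. -/
structure GaussianModel (ν : Measure X) [IsFiniteMeasure ν]
    {Ω : Type*} [MeasurableSpace Ω] (P : Measure Ω) where
  Z : X → Ω → ℝ
  mean : X → ℝ
  cov : C(X × X, ℝ)
  isGaussian : IsGaussianProcess Z P
  integral_eq : ∀ x, ∫ ω, Z x ω ∂P = mean x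
  covariance_eq : ∀ x y, ∫ ω, (Z x ω - mean x) * (Z y ω - mean y) ∂P = cov (x, y)
  memLp_mean : MemLp mean 2 ν
  cov_posDef : ∀ (s : Finset X) (α : X → ℝ), (∃ x ∈ s, α x ≠ 0) →
    0 < ∑ x ∈ s, ∑ y ∈ s, α x * α y * cov (x, y)
  covOp_posDef : ∀ w : Lp ℝ 2 ν, w ≠ 0 → 0 < ⟪covOp ν cov w, w⟫_ℝ

namespace GaussianModel

variable {ν : Measure X} [IsFiniteMeasure ν]
variable {Ω : Type*} [MeasurableSpace Ω] {P : Measure Ω} [IsProbabilityMeasure P]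

/-- The covariance operator of the model. -/
noncomputable def C (M : GaussianModel ν P) : Lp ℝ 2 ν →L[ℝ] Lp ℝ 2 ν := covOp ν M.cov

lemma memLp_centered (M : GaussianModel ν P) (x : X) :
    MemLp (fun ω => M.Z x ω - M.mean x) 2 P :=
  ((M.isGaussian.hasGaussianLaw_eval x).memLp_two).sub (memLp_const _)

/-- The centered process `Z⁰ = Z - m`, with values in `L₂(Ω, P)`. -/
noncomputable def Z0 (M : GaussianModel ν P) (x : X) : Lp ℝ 2 P := (M.memLp_centered x).toLp

/-- `ℋ⁰`: the closure in `L₂(Ω, P)` of the linear combinations of the centered process. -/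
noncomputable def H0 (M : GaussianModel ν P) : Submodule ℝ (Lp ℝ 2 P) :=
  (Submodule.span ℝ (Set.range M.Z0)).topologicalClosure

/-- The constants in `L₂(Ω, P)`. -/
noncomputable def constants (P : Measure Ω) [IsProbabilityMeasure P] : Submodule ℝ (Lp ℝ 2 P) :=
  Submodule.span ℝ {Lp.const 2 P (1 : ℝ)}

/-- `ℋ = ℝ ⊕ ℋ⁰`. -/
noncomputable def H (M : GaussianModel ν P) : Submodule ℝ (Lp ℝ 2 P) := constants P ⊔ M.H0

/-- `g` is the best linear predictor of `h` based on the subspace `W` (and the measure `P`):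
the orthogonal projection of `h` onto `W`. -/
def IsPredictor (W : Submodule ℝ (Lp ℝ 2 P)) (h g : Lp ℝ 2 P) : Prop :=
  g ∈ W ∧ ∀ f ∈ W, ∫ ω, (g - h) ω * f ω ∂P = 0

/-- The best linear predictor `hₙ` of `h` based on the (finite-dimensional) subspace `W`. -/
noncomputable def predictor (W : Submodule ℝ (Lp ℝ 2 P)) (h : Lp ℝ 2 P) : Lp ℝ 2 P :=
  Classical.epsilon (IsPredictor W h)

/-- The set of admissible sequences of subspaces: `ℋₙ = ℝ ⊕ ℋₙ⁰` with `ℋₙ⁰ ⊆ ℋ⁰` of dimension `n`,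
such that the predictors of every `h ∈ ℋ` are consistent. -/
structure Admissible (M : GaussianModel ν P) (Hn : ℕ → Submodule ℝ (Lp ℝ 2 P)) : Prop where
  form : ∀ n, ∃ V : Submodule ℝ (Lp ℝ 2 P), V ≤ M.H0 ∧ FiniteDimensional ℝ V ∧
    Module.finrank ℝ V = n ∧ Hn n = constants P ⊔ V
  consistent : ∀ h ∈ M.H,
    Tendsto (fun n => ∫ ω, ((predictor (Hn n) h - h) ω) ^ 2 ∂P) atTop (𝓝 0)

/-- The centered part `h - E[h]`. -/
noncomputable def center (h : Lp ℝ 2 P) : Lp ℝ 2 P := h - Lp.const 2 P (∫ ω, h ω ∂P)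

end GaussianModel

end Models

section TwoModels

open GaussianModel

variable {X : Type*} [MetricSpace X] [CompactSpace X] [MeasurableSpace X] [BorelSpace X]
  {ν : Measure X} [IsFiniteMeasure ν]
  {Ω : Type*} [MeasurableSpace Ω] {P : Measure Ω} [IsProbabilityMeasure P]
  {Ω' : Type*} [MeasurableSpace Ω'] {P' : Measure Ω'} [IsProbabilityMeasure P']

/-- The Cameron--Martin spaces `C^{1/2}(L₂)` and `C'^{1/2}(L₂)`, with the norms
`‖C^{1/2} v‖_* = ‖v‖` and `‖C'^{1/2} v'‖_* = ‖v'‖`, are norm equivalent Hilbert spaces. -/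
def AssumptionI (M : GaussianModel ν P) (M' : GaussianModel ν P') : Prop :=
  Set.range (opSqrt M.C) = Set.range (opSqrt M'.C) ∧
  ∃ k K : ℝ, 0 < k ∧ 0 < K ∧ ∀ v v' : Lp ℝ 2 ν, opSqrt M.C v = opSqrt M'.C v' →
    k * ‖v‖ ≤ ‖v'‖ ∧ ‖v'‖ ≤ K * ‖v‖

/-- The operator `C^{-1/2} C' C^{-1/2} - a I` is (defined and) compact on `L₂`: `T` is the bounded
operator with `T (C^{1/2} v) = C^{-1/2} C' v` for all `v`. -/
def AssumptionIII (M : GaussianModel ν P) (M' : GaussianModel ν P') (a : ℝ) : Prop :=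
  0 < a ∧ ∃ T : Lp ℝ 2 ν →L[ℝ] Lp ℝ 2 ν,
    (∀ v, opSqrt M.C (T (opSqrt M.C v)) = M'.C v) ∧
    IsCompactOperator (T - a • ContinuousLinearMap.id ℝ (Lp ℝ 2 ν))

/-- The closure in `L₂(Ω, P) × L₂(Ω', P')` of the set of pairs
`(∑ⱼ αⱼ Z⁰(xⱼ), ∑ⱼ αⱼ Z'⁰(xⱼ))`: the centered linear observables, of finite variance under both
models, together with their versions under both models (`ℋ⁰ ∩ ℋ'⁰`). -/
noncomputable def jointSpace (M : GaussianModel ν P) (M' : GaussianModel ν P') :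
    Submodule ℝ (Lp ℝ 2 P × Lp ℝ 2 P') :=
  (Submodule.span ℝ (Set.range fun x => (M.Z0 x, M'.Z0 x))).topologicalClosure

/-- A centered observable vanishes under one model if and only if it does under the other one.
Then every observable of the first model has at most one version under the second model, and
best linear predictors under the second model are unique, up to constants. -/
def Compatible (M : GaussianModel ν P) (M' : GaussianModel ν P') : Prop :=
  ∀ h h', (h, h') ∈ jointSpace M M' → (h = 0 ↔ h' = 0)

/-- `h ∈ ℋ` is also an observable of finite variance under the second model. -/
def IsCommon (M : GaussianModel ν P) (M' : GaussianModel ν P') (h : Lp ℝ 2 P) : Prop :=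
  ∃ h' : Lp ℝ 2 P', (center h, h') ∈ jointSpace M M'

/-- The version under the second model of the centered part `h - E[h]` of an observable `h`. -/
noncomputable def counterpart (M : GaussianModel ν P) (M' : GaussianModel ν P') (h : Lp ℝ 2 P) :
    Lp ℝ 2 P' :=
  Classical.epsilon fun h' => (center h, h') ∈ jointSpace M M'

/-- The variance of the observable `h` under the second model (additive constants, such as the
change of the mean, do not matter). -/
noncomputable def var' (M : GaussianModel ν P) (M' : GaussianModel ν P') (h : Lp ℝ 2 P) : ℝ :=
  Var[counterpart M M' h; P']

/-- `g` is, up to an additive constant, the best linear predictor of `h` based on the subspace `W`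
and the second model: it minimizes the variance of the error under the second model. -/
def IsPredictor' (M : GaussianModel ν P) (M' : GaussianModel ν P')
    (W : Submodule ℝ (Lp ℝ 2 P)) (h g : Lp ℝ 2 P) : Prop :=
  g ∈ W ∧ ∀ f ∈ W, var' M M' (g - h) ≤ var' M M' (f - h)

/-- The best linear predictor of `h` based on `W` and the second model, up to a constant (which
changes no variance of the error). -/
noncomputable def predictor' (M : GaussianModel ν P) (M' : GaussianModel ν P')
    (W : Submodule ℝ (Lp ℝ 2 P)) (h : Lp ℝ 2 P) : Lp ℝ 2 P :=
  Classical.epsilon (IsPredictor' M M' W h)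

/-- The set `ℋ₋ₙ` of the `h ∈ ℋ` (with a version under the second model) with
`E[(hₙ - h)²] > 0`. -/
def Hminus (M : GaussianModel ν P) (M' : GaussianModel ν P') (W : Submodule ℝ (Lp ℝ 2 P)) :
    Set (Lp ℝ 2 P) :=
  {h | h ∈ M.H ∧ IsCommon M M' h ∧ 0 < ∫ ω, ((predictor W h - h) ω) ^ 2 ∂P}

/-- For all admissible sequences `(ℋₙ)` (of observables that have versions under both models),
`sup_{h ∈ ℋ₋ₙ} F(ℋₙ, h) → l` as `n → ∞`; it is part of the assertion that the variances and the
predictors under the second model are well-defined. The supremum is taken in `[0, ∞]`. -/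
def UniformLimit (M : GaussianModel ν P) (M' : GaussianModel ν P')
    (F : Submodule ℝ (Lp ℝ 2 P) → Lp ℝ 2 P → ℝ) (l : ℝ≥0∞) : Prop :=
  Compatible M M' ∧
  ∀ Hn : ℕ → Submodule ℝ (Lp ℝ 2 P), M.Admissible Hn →
    (∀ n, ∀ g ∈ Hn n, IsCommon M M' g) →
    Tendsto (fun n => ⨆ h ∈ Hminus M M' (Hn n), ENNReal.ofReal (F (Hn n) h)) atTop (𝓝 l)

/-- `lim sup_h Var[h̃ₙ - h] / Var[hₙ - h] = 1`. -/
def Assertion1 (M : GaussianModel ν P) (M' : GaussianModel ν P') : Prop :=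
  UniformLimit M M'
    (fun W h => Var[predictor' M M' W h - h; P] / Var[predictor W h - h; P]) 1

/-- `lim sup_h Var'[hₙ - h] / Var'[h̃ₙ - h] = 1`. -/
def Assertion2 (M : GaussianModel ν P) (M' : GaussianModel ν P') : Prop :=
  UniformLimit M M'
    (fun W h => var' M M' (predictor W h - h) / var' M M' (predictor' M M' W h - h)) 1

/-- `lim sup_h |Var'[hₙ - h] / Var[hₙ - h] - a| = 0`. -/
def Assertion3 (M : GaussianModel ν P) (M' : GaussianModel ν P') (a : ℝ) : Prop :=
  UniformLimit M M'
    (fun W h => |var' M M' (predictor W h - h) / Var[predictor W h - h; P] - a|) 0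

/-- `lim sup_h |Var[h̃ₙ - h] / Var'[h̃ₙ - h] - 1 / a| = 0`. -/
def Assertion4 (M : GaussianModel ν P) (M' : GaussianModel ν P') (a : ℝ) : Prop :=
  UniformLimit M M'
    (fun W h => |Var[predictor' M M' W h - h; P] / var' M M' (predictor' M M' W h - h) - 1 / a|) 0

end TwoModels

end Kriging

/-!
# Uniformly asymptotically optimal linear prediction with misspecified second order structure

An observable of finite variance under both models is a point of the closed space `D = jointSpace`,
with two maps `p = jointFst` and `p' = jointSnd` to its versions under the two models; `‖p g‖²` and
`‖p' g‖²` are its variances. All four assertions, and both assumptions, are statements about these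
two quadratic forms on `D`, and the proof takes place there. The forms play symmetric roles.

*Assumptions.* The unitary part of the polar decomposition of `w ↦ ∫ w(x) Z⁰(x) dν(x)` identifies
`L₂(X, ν)` with `ℋ⁰` (`GaussianModel.exists_isometry`). Through it, norm equivalence of the
Cameron–Martin spaces becomes equivalence of the two forms (`assumptionI_iff`), and compactness of
`C^{-1/2} C' C^{-1/2} - a` becomes `FormApprox p p' a`: the form `‖p' g‖² - a ‖p g‖²` is arbitrarily
small, relative to `‖p g‖²`, on the complements of suitable finite-dimensional spaces
(`assumptionIII_iff`).

*Assertions.* The errors of the two predictions of `h` from `V` are the parts `g`, `g'` of `h`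
that are perpendicular to `V` in the first and in the second form. The last two assertions say that
`‖p' g‖² - a ‖p g‖²` is eventually small for `g` perpendicular to `V n` (in the one or the other
form). The first two say that `‖p g'‖² ≤ (1 + ε) ‖p g‖²`, or the same with the forms exchanged,
which amounts to a small cosine, in one form, between `V n` and its complement in the other one.

*Sufficiency.* If the difference of the forms is relatively compact, then it is small as soon as
one argument is perpendicular to `V n`, for any sequence whose predictors are consistent
(`FormApprox.eventually_abs_formDiff_le`); this controls both the differences and the cosines.
`FormApprox.symm` exchanges the forms.

*Necessity.* For the last two assertions a single admissible sequence suffices. For the first two,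
a diagonal argument (`exists_forall_ge_of_forall_seq`) gives a space `F` such that the cosine is at
most `δ` for all `V ≥ F`. For `u`, `w` perpendicular to `F` and of equal norm, `u - w` and `u + w`
are perpendicular, and `V = F + ℝ (u + w)` shows that their images are almost perpendicular, so
`‖p' u‖` and `‖p' w‖` are almost equal. Hence the ratio of the two forms is almost constant on the
complement of `F`, and the constants converge to some `a > 0` as `δ → 0`
(`formEquiv_and_formApprox_of_abs_inner_le`). In both cases the two forms are equivalent on the
complement of a finite-dimensional space, and then everywhere because `D` is complete and `p`, `p'`
are injective (`formEquiv_of_perp`).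
-/

namespace Kriging

/-! ### Two quadratic forms -/

section Forms

variable {D E E' : Type*} [NormedAddCommGroup D] [NormedSpace ℝ D]
  [NormedAddCommGroup E] [InnerProductSpace ℝ E]
  [NormedAddCommGroup E'] [InnerProductSpace ℝ E']

/-- `g` is perpendicular to `V` in the inner product pulled back along `p`. -/
def PerpTo (p : D →L[ℝ] E) (V : Submodule ℝ D) (g : D) : Prop := ∀ v ∈ V, ⟪p g, p v⟫_ℝ = 0

/-- The seminorms `‖p g‖` and `‖p' g‖` are equivalent. -/
def FormEquiv (p : D →L[ℝ] E) (p' : D →L[ℝ] E') : Prop :=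
  ∃ k K : ℝ, 0 < k ∧ 0 < K ∧ ∀ g, k * ‖p g‖ ≤ ‖p' g‖ ∧ ‖p' g‖ ≤ K * ‖p g‖

/-- The quadratic form `‖p' g‖² - a ‖p g‖²` is at most `ε ‖p g‖²` in absolute value on the elements
perpendicular to `V`. -/
def DiffLe (p : D →L[ℝ] E) (p' : D →L[ℝ] E') (a ε : ℝ) (V : Submodule ℝ D) : Prop :=
  ∀ g, PerpTo p V g → |‖p' g‖ ^ 2 - a * ‖p g‖ ^ 2| ≤ ε * ‖p g‖ ^ 2

/-- The form `⟪p' ·, p' ·⟫ - a ⟪p ·, p ·⟫` is compact relative to `⟪p ·, p ·⟫`: it is arbitrarily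
small on the complements of suitable finite-dimensional spaces. -/
def FormApprox (p : D →L[ℝ] E) (p' : D →L[ℝ] E') (a : ℝ) : Prop :=
  ∀ ε : ℝ, 0 < ε → ∃ V : Submodule ℝ D, FiniteDimensional ℝ V ∧ DiffLe p p' a ε V

variable {p : D →L[ℝ] E} {p' : D →L[ℝ] E'}

lemma FormEquiv.symm (h : FormEquiv p p') : FormEquiv p' p := by
  obtain ⟨k, K, hk, hK, h⟩ := h
  refine ⟨K⁻¹, k⁻¹, by positivity, by positivity, fun g => ⟨?_, ?_⟩⟩
  · rw [inv_mul_le_iff₀ hK]; exact (h g).2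
  · rw [le_inv_mul_iff₀ hk]; exact (h g).1

lemma PerpTo.mono {V W : Submodule ℝ D} (hVW : V ≤ W) {g : D} (h : PerpTo p W g) :
    PerpTo p V g := fun v hv => h v (hVW hv)

lemma exists_perpTo_sub (p : D →L[ℝ] E) (V : Submodule ℝ D) [FiniteDimensional ℝ V] (g : D) :
    ∃ v ∈ V, PerpTo p V (g - v) := by
  obtain ⟨v, hv, hpv⟩ := Submodule.mem_map.1
    ((V.map (p : D →ₗ[ℝ] E)).starProjection_apply_mem (p g))
  refine ⟨v, hv, fun w hw => ?_⟩
  have := (V.map (p : D →ₗ[ℝ] E)).starProjection_inner_eq_zero (p g) (p w)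
    (Submodule.mem_map_of_mem (f := (p : D →ₗ[ℝ] E)) hw)
  rw [map_sub]
  rw [← hpv] at this
  exact this

lemma exists_perpTo_ne_zero (p : D →L[ℝ] E) (hD : ¬ FiniteDimensional ℝ D) (V : Submodule ℝ D)
    [FiniteDimensional ℝ V] : ∃ g, g ≠ 0 ∧ PerpTo p V g := by
  by_contra! h
  refine hD ?_
  have : V = ⊤ := by
    rw [eq_top_iff]
    intro g _
    obtain ⟨v, hv, hg⟩ := exists_perpTo_sub p V g
    by_contra hgV
    refine h (g - v) (fun h0 => hgV ?_) hg
    rw [sub_eq_zero] at h0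
    rwa [h0]
  subst this
  exact Module.Finite.equiv (Submodule.topEquiv (R := ℝ) (M := D))

lemma PerpTo.norm_add_sq {V : Submodule ℝ D} {g v : D} (h : PerpTo p V g) (hv : v ∈ V) :
    ‖p (g + v)‖ ^ 2 = ‖p g‖ ^ 2 + ‖p v‖ ^ 2 := by
  rw [map_add, norm_add_sq_real, h v hv]; ring

lemma PerpTo.eq_zero_of_mem (hp : Function.Injective p) {V : Submodule ℝ D} {g : D}
    (h : PerpTo p V g) (hg : g ∈ V) : g = 0 :=
  hp (by rw [inner_self_eq_zero.1 (h g hg), map_zero])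

lemma norm_sq_pos_of_ne_zero (hp : Function.Injective p) {g : D} (hg : g ≠ 0) : 0 < ‖p g‖ ^ 2 :=
  pow_pos (norm_pos_iff.2 fun h0 => hg (hp (by rw [h0, map_zero]))) 2

lemma PerpTo.ne_zero_of_sub_mem (hp : Function.Injective p) {V : Submodule ℝ D} {g g' : D}
    (hg : PerpTo p V g) (hgg : g - g' ∈ V) (hg0 : g ≠ 0) :
    g' ≠ 0 := by
  rintro rfl
  exact hg0 (hg.eq_zero_of_mem hp (by rwa [sub_zero] at hgg))

/-- Polarization: a symmetric bilinear form that is small on the diagonal is small. -/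
lemma abs_apply_le_of_abs_apply_self_le (B : D →ₗ[ℝ] D →ₗ[ℝ] ℝ) (hB : ∀ g h, B g h = B h g)
    (p : D →L[ℝ] E) (W : Submodule ℝ D) {ε : ℝ} (hε : 0 ≤ ε)
    (h : ∀ g ∈ W, |B g g| ≤ ε * ‖p g‖ ^ 2) {u w : D} (hu : u ∈ W) (hw : w ∈ W) :
    |B u w| ≤ ε * ‖p u‖ * ‖p w‖ := by
  have key : ∀ t : ℝ, 0 ≤ (ε * ‖p u‖ ^ 2) * (t * t) + (-(2 * B u w)) * t + ε * ‖p w‖ ^ 2 := by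
    intro t
    have h1 := (abs_le.1 (h (t • u + w) (W.add_mem (W.smul_mem t hu) hw))).2
    have h2 := (abs_le.1 (h (t • u - w) (W.sub_mem (W.smul_mem t hu) hw))).1
    have h3 := parallelogram_law_with_norm ℝ (p (t • u)) (p w)
    have h4 : ‖p (t • u)‖ = |t| * ‖p u‖ := by rw [map_smul, norm_smul, Real.norm_eq_abs]
    have h5 : |t| * |t| = t * t := abs_mul_abs_self t
    simp only [map_add, map_sub, LinearMap.add_apply, LinearMap.sub_apply] at h1 h2
    simp only [map_smul, LinearMap.smul_apply, smul_eq_mul, hB w u] at h1 h2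
    rw [h4] at h3
    simp only [map_smul] at h3
    have h6 : ε * (‖t • p u + p w‖ ^ 2 + ‖t • p u - p w‖ ^ 2)
      = ε * (2 * (t * t * ‖p u‖ ^ 2 + ‖p w‖ ^ 2)) := by
      rw [← h5]; linear_combination ε * h3
    linarith
  have := discrim_le_zero key
  rw [discrim] at this
  refine abs_le_of_sq_le_sq ?_ (by positivity)
  nlinarith

/-- The form `⟪p' g, p' h⟫ - a ⟪p g, p h⟫`. -/
noncomputable def formDiff (p : D →L[ℝ] E) (p' : D →L[ℝ] E') (a : ℝ) : D →ₗ[ℝ] D →ₗ[ℝ] ℝ :=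
  (innerₗ E').compl₁₂ (p' : D →ₗ[ℝ] E') (p' : D →ₗ[ℝ] E') -
    a • (innerₗ E).compl₁₂ (p : D →ₗ[ℝ] E) (p : D →ₗ[ℝ] E)

lemma formDiff_apply (p : D →L[ℝ] E) (p' : D →L[ℝ] E') (a : ℝ) (g h : D) :
    formDiff p p' a g h = ⟪p' g, p' h⟫_ℝ - a * ⟪p g, p h⟫_ℝ := by
  simp [formDiff]

lemma formDiff_comm (a : ℝ) (g h : D) : formDiff p p' a g h = formDiff p p' a h g := by
  rw [formDiff_apply, formDiff_apply, real_inner_comm, real_inner_comm (p h)]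

lemma formDiff_self (a : ℝ) (g : D) :
    formDiff p p' a g g = ‖p' g‖ ^ 2 - a * ‖p g‖ ^ 2 := by
  rw [formDiff_apply, real_inner_self_eq_norm_sq, real_inner_self_eq_norm_sq]

/-- The elements perpendicular to `V`, as a submodule. -/
noncomputable def perpSubmodule (p : D →L[ℝ] E) (V : Submodule ℝ D) : Submodule ℝ D :=
  (V.map (p : D →ₗ[ℝ] E))ᗮ.comap (p : D →ₗ[ℝ] E)

lemma mem_perpSubmodule {V : Submodule ℝ D} {g : D} :
    g ∈ perpSubmodule p V ↔ PerpTo p V g := by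
  simp [perpSubmodule, PerpTo, Submodule.mem_orthogonal']

lemma isClosed_perpSubmodule (V : Submodule ℝ D) : IsClosed (perpSubmodule p V : Set D) :=
  (Submodule.isClosed_orthogonal _).preimage p.continuous

/-- An injective operator that is bounded below on the complement of a finite-dimensional space is
bounded below, since its range is closed. -/
lemma exists_norm_le_of_perp {F : Type*} [NormedAddCommGroup F] [NormedSpace ℝ F]
    [CompleteSpace F] [CompleteSpace D] (f : D →L[ℝ] F) (hf : Function.Injective f)
    (V : Submodule ℝ D) [FiniteDimensional ℝ V] {c : ℝ}
    (hc : ∀ g, PerpTo p V g → ‖g‖ ≤ c * ‖f g‖) : ∃ c' : ℝ, ∀ g, ‖g‖ ≤ c' * ‖f g‖ := by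
  have hclosed : IsClosed (((perpSubmodule p V).map (f : D →ₗ[ℝ] F) : Submodule ℝ F) : Set F) := by
    have : CompleteSpace (perpSubmodule p V) :=
      (isClosed_perpSubmodule V).completeSpace_coe
    let f0 := f.comp (perpSubmodule p V).subtypeL
    have hanti : AntilipschitzWith (Real.toNNReal c) f0 :=
      f0.antilipschitz_of_bound fun g => (hc g (mem_perpSubmodule.1 g.2)).trans
        (mul_le_mul_of_nonneg_right (Real.le_coe_toNNReal c) (norm_nonneg _))
    have := hanti.isClosed_range f0.uniformContinuous
    convert this
    ext y
    simp [f0]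
  have hrange : IsClosed (Set.range f) := by
    have h1 := Submodule.isClosed_sup_finiteDimensional _ (V.map (f : D →ₗ[ℝ] F)) hclosed
    convert h1
    ext y
    constructor
    · rintro ⟨g, rfl⟩
      obtain ⟨v, hv, hg⟩ := exists_perpTo_sub p V g
      exact Submodule.mem_sup.2 ⟨f (g - v), ⟨_, mem_perpSubmodule.2 hg, rfl⟩, f v, ⟨v, hv, rfl⟩,
        by rw [← map_add, sub_add_cancel]⟩
    · intro hy
      obtain ⟨_, ⟨g, -, rfl⟩, _, ⟨v, -, rfl⟩, rfl⟩ := Submodule.mem_sup.1 hy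
      exact ⟨g + v, map_add f g v⟩
  obtain ⟨K, hK⟩ := f.antilipschitz_of_injective_of_isClosed_range hf hrange
  exact ⟨K, fun g => ContinuousLinearMap.bound_of_antilipschitz f hK g⟩

/-- Two-sided bounds on the complement of a finite-dimensional space extend to the whole space: by
completeness both maps have closed range, and they are injective. -/
lemma formEquiv_of_perp [CompleteSpace D] [CompleteSpace E] [CompleteSpace E']
    (hgraph : ∀ g, ‖g‖ ≤ ‖p g‖ + ‖p' g‖) (hp : Function.Injective p) (hp' : Function.Injective p')
    (V : Submodule ℝ D) [FiniteDimensional ℝ V] {c C : ℝ} (hc : 0 < c)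
    (h : ∀ g, PerpTo p V g → c * ‖p g‖ ≤ ‖p' g‖ ∧ ‖p' g‖ ≤ C * ‖p g‖) : FormEquiv p p' := by
  obtain ⟨c1, h1⟩ := exists_norm_le_of_perp p hp V (c := 1 + C) fun g hg => by
    linarith [hgraph g, (h g hg).2]
  obtain ⟨c2, h2⟩ := exists_norm_le_of_perp p' hp' V (c := c⁻¹ + 1) fun g hg => by
    have := (le_inv_mul_iff₀ hc).2 (h g hg).1
    linarith [hgraph g]
  have hb : ∀ (c : ℝ) (x y : ℝ), 0 ≤ y → x ≤ c * y → x ≤ max c 1 * y := fun c x y hy hx =>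
    hx.trans (mul_le_mul_of_nonneg_right (le_max_left _ _) hy)
  have hpos : ∀ c : ℝ, 0 < max c 1 := fun c => lt_max_of_lt_right one_pos
  refine ⟨((max ‖p‖ 1) * max c2 1)⁻¹, max ‖p'‖ 1 * max c1 1,
    inv_pos.2 (mul_pos (hpos _) (hpos _)), mul_pos (hpos _) (hpos _), fun g => ⟨?_, ?_⟩⟩
  · rw [inv_mul_le_iff₀ (mul_pos (hpos _) (hpos _)), mul_assoc]
    exact (hb _ _ _ (norm_nonneg _) (p.le_opNorm g)).trans
      (mul_le_mul_of_nonneg_left (hb _ _ _ (norm_nonneg _) (h2 g)) (hpos _).le)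
  · rw [mul_assoc]
    exact (hb _ _ _ (norm_nonneg _) (p'.le_opNorm g)).trans
      (mul_le_mul_of_nonneg_left (hb _ _ _ (norm_nonneg _) (h1 g)) (hpos _).le)

lemma FormEquiv.exists_antilipschitzWith (hgraph : ∀ g, ‖g‖ ≤ ‖p g‖ + ‖p' g‖) (h : FormEquiv p p') :
    ∃ c : NNReal, AntilipschitzWith c p' := by
  obtain ⟨k, K, hk, hK, h⟩ := h
  refine ⟨Real.toNNReal (k⁻¹ + 1), p'.antilipschitz_of_bound fun g => ?_⟩
  rw [Real.coe_toNNReal _ (by positivity)]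
  have := (le_inv_mul_iff₀ hk).2 (h g).1
  linarith [hgraph g]

lemma FormEquiv.isClosed_range [CompleteSpace D] (hgraph : ∀ g, ‖g‖ ≤ ‖p g‖ + ‖p' g‖)
    (h : FormEquiv p p') : IsClosed (Set.range p') := by
  obtain ⟨c, hc⟩ := h.exists_antilipschitzWith hgraph
  exact hc.isClosed_range p'.uniformContinuous

/-- Riesz representation for the form `⟪p' ·, p' ·⟫`. -/
lemma FormEquiv.exists_inner_eq [CompleteSpace D] [CompleteSpace E']
    (hgraph : ∀ g, ‖g‖ ≤ ‖p g‖ + ‖p' g‖) (h : FormEquiv p p') (x : E) :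
    ∃ z : D, ∀ g, ⟪p' g, p' z⟫_ℝ = ⟪p g, x⟫_ℝ := by
  obtain ⟨c, hc⟩ := h.exists_antilipschitzWith hgraph
  have hcl := h.isClosed_range hgraph
  let e := p'.equivRange hc.injective hcl
  have : CompleteSpace (LinearMap.range (p' : D →ₗ[ℝ] E')) :=
    IsClosed.completeSpace_coe (s := (Set.range p' : Set E')) (hs := hcl)
  let φ : LinearMap.range (p' : D →ₗ[ℝ] E') →L[ℝ] ℝ :=
    (innerSL ℝ x).comp (p.comp e.symm.toContinuousLinearMap)
  obtain ⟨⟨_, z, rfl⟩, hz⟩ := (InnerProductSpace.toDual ℝ _).surjective φ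
  refine ⟨z, fun g => ?_⟩
  have := congrArg (fun ψ => ψ ⟨p' g, g, rfl⟩) hz
  simp only [InnerProductSpace.toDual_apply_apply] at this
  rw [real_inner_comm, real_inner_comm x]
  refine this.trans ?_
  have he : e.symm ⟨p' g, g, rfl⟩ = g := by
    rw [ContinuousLinearEquiv.symm_apply_eq]; rfl
  simp only [φ, ContinuousLinearMap.comp_apply, innerSL_apply_apply]
  congr 2

/-! ### Relatively compact differences of forms -/

/-- If all functionals `Ψ · v` are of the form `Φ · z`, then annihilation of a finite-dimensional
space under `Ψ` is implied by annihilation of a finite-dimensional space under `Φ`. -/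
lemma exists_finiteDimensional_represent (Φ Ψ : D → D →ₗ[ℝ] ℝ)
    (h : ∀ v, ∃ z, ∀ g, Φ g z = Ψ g v) (V : Submodule ℝ D) [FiniteDimensional ℝ V] :
    ∃ W : Submodule ℝ D, FiniteDimensional ℝ W ∧
      ∀ g, (∀ z ∈ W, Φ g z = 0) → ∀ v ∈ V, Ψ g v = 0 := by
  choose z hz using h
  obtain ⟨s, hs⟩ := (Submodule.fg_iff_finiteDimensional V).2 inferInstance
  refine ⟨Submodule.span ℝ (z '' s), FiniteDimensional.span_of_finite ℝ (s.finite_toSet.image z),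
    fun g hg v hv => ?_⟩
  have : Submodule.span ℝ (s : Set D) ≤ LinearMap.ker (Ψ g) := by
    rw [Submodule.span_le]
    intro x hx
    rw [SetLike.mem_coe, LinearMap.mem_ker, ← hz]
    exact hg _ (Submodule.subset_span ⟨x, hx, rfl⟩)
  rw [hs] at this
  exact this hv

/-- Exchange of the two forms. Perpendicularity to `V` in the first form is perpendicularity in the
second form to the Riesz representatives of the elements of `V`. -/
lemma FormApprox.symm [CompleteSpace D] [CompleteSpace E']
    (hgraph : ∀ g, ‖g‖ ≤ ‖p g‖ + ‖p' g‖) (he : FormEquiv p p') {a : ℝ} (ha : 0 < a)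
    (h : FormApprox p p' a) : FormApprox p' p a⁻¹ := by
  intro ε hε
  obtain ⟨k, K, hk, hK, hkK⟩ := id he
  obtain ⟨V, hV, hVa⟩ := h (ε * a * k ^ 2) (by positivity)
  obtain ⟨W, hW, hWV⟩ := exists_finiteDimensional_represent
    (fun g => (innerₗ E' (p' g)).comp (p' : D →ₗ[ℝ] E'))
    (fun g => (innerₗ E (p g)).comp (p : D →ₗ[ℝ] E))
    (fun v => he.exists_inner_eq hgraph (p v)) V
  refine ⟨W, hW, fun g hg => ?_⟩
  have h1 := hVa g (hWV g hg)
  have h2 : (k * ‖p g‖) ^ 2 ≤ ‖p' g‖ ^ 2 := pow_le_pow_left₀ (by positivity) (hkK g).1 2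
  have h3 : ‖p g‖ ^ 2 - a⁻¹ * ‖p' g‖ ^ 2 = -(a⁻¹ * (‖p' g‖ ^ 2 - a * ‖p g‖ ^ 2)) := by
    field_simp; ring
  rw [h3, abs_neg, abs_mul, abs_of_pos (inv_pos.2 ha), inv_mul_le_iff₀ ha]
  nlinarith [mul_pos hε ha]

/-- The form `formDiff p p' a` is small as soon as one of its arguments is perpendicular to a
suitable finite-dimensional space. To the space `V` that makes it small on the diagonal one adds
the Riesz representatives that make it vanish on the products with elements of `V`. -/
lemma FormApprox.exists_abs_formDiff_le [CompleteSpace D] [CompleteSpace E]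
    (hgraph : ∀ g, ‖g‖ ≤ ‖p g‖ + ‖p' g‖) (he : FormEquiv p p') {a : ℝ}
    (h : FormApprox p p' a) {ε : ℝ} (hε : 0 < ε) :
    ∃ V : Submodule ℝ D, FiniteDimensional ℝ V ∧
      ∀ g, PerpTo p V g → ∀ h, |formDiff p p' a g h| ≤ ε * ‖p g‖ * ‖p h‖ := by
  obtain ⟨V, hV, hVa⟩ := h ε hε
  obtain ⟨W, hW, hWV⟩ := exists_finiteDimensional_represent
    (fun g => (innerₗ E (p g)).comp (p : D →ₗ[ℝ] E))
    (fun g => (innerₗ E' (p' g)).comp (p' : D →ₗ[ℝ] E'))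
    (fun v => he.symm.exists_inner_eq (fun g => by rw [add_comm]; exact hgraph g) (p' v)) V
  refine ⟨V ⊔ W, inferInstance, fun g hg h => ?_⟩
  obtain ⟨v, hv, hb⟩ := exists_perpTo_sub p V h
  have h0 : formDiff p p' a g v = 0 := by
    have h1 : ⟪p' g, p' v⟫_ℝ = 0 := hWV g (hg.mono le_sup_right) v hv
    have h2 : ⟪p g, p v⟫_ℝ = 0 := hg.mono le_sup_left v hv
    rw [formDiff_apply, h1, h2]; ring
  have h1 : formDiff p p' a g h = formDiff p p' a g (h - v) := by
    rw [map_sub, h0, sub_zero]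
  have h2 : ‖p (h - v)‖ ≤ ‖p h‖ := by
    have := hb.norm_add_sq hv
    rw [sub_add_cancel] at this
    exact le_of_sq_le_sq (by nlinarith [sq_nonneg ‖p v‖]) (norm_nonneg _)
  rw [h1]
  refine (abs_apply_le_of_abs_apply_self_le (formDiff p p' a) (formDiff_comm a) p
    (perpSubmodule p V) hε.le (fun g hg => ?_) (mem_perpSubmodule.2 (hg.mono le_sup_left))
    (mem_perpSubmodule.2 hb)).trans ?_
  · rw [formDiff_self]; exact hVa g (mem_perpSubmodule.1 hg)
  · exact mul_le_mul_of_nonneg_left h2 (by positivity)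

/-- All elements of `D` are, in the norm `‖p ·‖`, limits of elements of the spaces `V n`. -/
def Consistent (p : D →L[ℝ] E) (V : ℕ → Submodule ℝ D) : Prop :=
  ∀ g, ∀ ε : ℝ, 0 < ε → ∀ᶠ n in atTop, ∃ v ∈ V n, ‖p g - p v‖ ≤ ε

lemma Consistent.of_formEquiv (he : FormEquiv p p') {V : ℕ → Submodule ℝ D}
    (h : Consistent p V) : Consistent p' V := by
  intro g ε hε
  obtain ⟨k, K, hk, hK, hkK⟩ := he
  filter_upwards [h g (ε / K) (by positivity)] with n hn
  obtain ⟨v, hv, hgv⟩ := hn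
  refine ⟨v, hv, ?_⟩
  rw [← map_sub] at hgv ⊢
  refine (hkK _).2.trans ?_
  rwa [mul_comm, ← le_div_iff₀ hK]

/-- The complements of a consistent sequence are asymptotically perpendicular to every
finite-dimensional space. -/
lemma Consistent.eventually_abs_inner_le {V : ℕ → Submodule ℝ D} (h : Consistent p V)
    (F : Submodule ℝ D) [FiniteDimensional ℝ F] {η : ℝ} (hη : 0 < η) :
    ∀ᶠ n in atTop, ∀ g, PerpTo p (V n) g → ∀ f ∈ F, |⟪p g, p f⟫_ℝ| ≤ η * ‖p g‖ * ‖p f‖ := by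
  let e := stdOrthonormalBasis ℝ (F.map (p : D →ₗ[ℝ] E))
  set N := Module.finrank ℝ (F.map (p : D →ₗ[ℝ] E))
  have hη' : 0 < η / (N + 1) := by positivity
  have hev : ∀ i, ∀ᶠ n in atTop, ∃ v ∈ V n, ‖(e i : E) - p v‖ ≤ η / (N + 1) := fun i => by
    obtain ⟨f, -, hf⟩ := Submodule.mem_map.1 (e i).2
    filter_upwards [h f _ hη'] with n hn
    rwa [← hf]
  filter_upwards [eventually_all.2 hev] with n hn g hg f hf
  have h1 : ∀ i, |⟪p g, (e i : E)⟫_ℝ| ≤ ‖p g‖ * (η / (N + 1)) := by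
    intro i
    obtain ⟨v, hv, hle⟩ := hn i
    have : ⟪p g, (e i : E)⟫_ℝ = ⟪p g, (e i : E) - p v⟫_ℝ := by
      rw [inner_sub_right, hg v hv, sub_zero]
    rw [this]
    exact (abs_real_inner_le_norm _ _).trans (mul_le_mul_of_nonneg_left hle (norm_nonneg _))
  let y : F.map (p : D →ₗ[ℝ] E) := ⟨p f, Submodule.mem_map_of_mem (f := (p : D →ₗ[ℝ] E)) hf⟩
  have h2 : p f = ∑ i, ⟪e i, y⟫_ℝ • (e i : E) := by
    have := congrArg (Subtype.val) (e.sum_repr' y)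
    rw [← show ((y : F.map (p : D →ₗ[ℝ] E)) : E) = p f from rfl, ← this]
    simp
  have h3 : ⟪p g, p f⟫_ℝ = ∑ i, ⟪e i, y⟫_ℝ * ⟪p g, (e i : E)⟫_ℝ := by
    conv_lhs => rw [h2]
    rw [inner_sum]
    simp only [inner_smul_right]
  have h4 : ∀ i, |⟪e i, y⟫_ℝ| ≤ ‖p f‖ := fun i =>
    (abs_real_inner_le_norm _ _).trans (by rw [e.norm_eq_one, one_mul]; rfl)
  rw [h3]
  calc |∑ i, ⟪e i, y⟫_ℝ * ⟪p g, (e i : E)⟫_ℝ|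
      ≤ ∑ i, |⟪e i, y⟫_ℝ * ⟪p g, (e i : E)⟫_ℝ| := Finset.abs_sum_le_sum_abs _ _
    _ ≤ ∑ _i : Fin N, ‖p f‖ * (‖p g‖ * (η / (N + 1))) := Finset.sum_le_sum fun i _ => by
        rw [abs_mul]
        exact mul_le_mul (h4 i) (h1 i) (abs_nonneg _) (norm_nonneg _)
    _ = (N / (N + 1)) * (η * ‖p g‖ * ‖p f‖) := by
        rw [Finset.sum_const, Finset.card_univ, Fintype.card_fin, nsmul_eq_mul]
        field_simp
    _ ≤ 1 * (η * ‖p g‖ * ‖p f‖) := by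
        refine mul_le_mul_of_nonneg_right ?_ (by positivity)
        rw [div_le_one (by positivity)]; linarith
    _ = _ := one_mul _

/-- In `FormApprox` the finite-dimensional spaces can be taken from any consistent sequence. -/
lemma FormApprox.eventually_abs_formDiff_le [CompleteSpace D] [CompleteSpace E]
    (hgraph : ∀ g, ‖g‖ ≤ ‖p g‖ + ‖p' g‖) (he : FormEquiv p p') {a : ℝ}
    (h : FormApprox p p' a) {V : ℕ → Submodule ℝ D} (hV : Consistent p V) {ε : ℝ} (hε : 0 < ε) :
    ∀ᶠ n in atTop, ∀ g, PerpTo p (V n) g → ∀ h,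
      |formDiff p p' a g h| ≤ ε * ‖p g‖ * ‖p h‖ := by
  obtain ⟨k, K, hk, hK, hkK⟩ := id he
  obtain ⟨F, hF, hFa⟩ := h.exists_abs_formDiff_le hgraph he (half_pos hε)
  have hC : 0 < K ^ 2 + |a| := by positivity
  have hB : ∀ v h, |formDiff p p' a v h| ≤ (K ^ 2 + |a|) * ‖p v‖ * ‖p h‖ := by
    intro v h
    rw [formDiff_apply]
    have h1 := abs_real_inner_le_norm (p' v) (p' h)
    have h2 := abs_real_inner_le_norm (p v) (p h)
    have h3 : ‖p' v‖ * ‖p' h‖ ≤ (K * ‖p v‖) * (K * ‖p h‖) :=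
      mul_le_mul (hkK v).2 (hkK h).2 (norm_nonneg _) (by positivity)
    refine (abs_sub _ _).trans ?_
    rw [abs_mul]
    have h4 := mul_le_mul_of_nonneg_left h2 (abs_nonneg a)
    nlinarith
  filter_upwards [hV.eventually_abs_inner_le F (η := ε / (2 * (K ^ 2 + |a|))) (by positivity)]
    with n hn g hg h
  obtain ⟨v, hv, hw⟩ := exists_perpTo_sub p F g
  have hpy := hw.norm_add_sq hv
  rw [sub_add_cancel] at hpy
  have h1 : ‖p (g - v)‖ ≤ ‖p g‖ :=
    le_of_sq_le_sq (by nlinarith [sq_nonneg ‖p v‖]) (norm_nonneg _)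
  have h2 : ‖p v‖ ≤ ε / (2 * (K ^ 2 + |a|)) * ‖p g‖ := by
    have h3 := (abs_le.1 (hn g hg v hv)).2
    have h4 : ⟪p g, p v⟫_ℝ = ‖p v‖ * ‖p v‖ := by
      have := hw v hv
      rw [map_sub, inner_sub_left, sub_eq_zero] at this
      rw [this, real_inner_self_eq_norm_mul_norm]
    rw [h4] at h3
    rcases (norm_nonneg (p v)).eq_or_lt with h0 | h0
    · rw [← h0]; positivity
    · exact le_of_mul_le_mul_right h3 h0
  have h5 : formDiff p p' a g h = formDiff p p' a (g - v) h + formDiff p p' a v h := by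
    rw [← LinearMap.add_apply, ← map_add, sub_add_cancel]
  rw [h5]
  refine (abs_add_le _ _).trans ((add_le_add (hFa _ hw h) (hB v h)).trans ?_)
  have h6 : (K ^ 2 + |a|) * ‖p v‖ ≤ ε / 2 * ‖p g‖ := by
    refine (mul_le_mul_of_nonneg_left h2 hC.le).trans (le_of_eq ?_)
    field_simp
  have h7 : ε / 2 * ‖p (g - v)‖ ≤ ε / 2 * ‖p g‖ :=
    mul_le_mul_of_nonneg_left h1 (by positivity)
  rw [← add_mul]
  refine mul_le_mul_of_nonneg_right ?_ (norm_nonneg _)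
  linarith

lemma FormApprox.eventually_diffLe [CompleteSpace D] [CompleteSpace E]
    (hgraph : ∀ g, ‖g‖ ≤ ‖p g‖ + ‖p' g‖) (he : FormEquiv p p') {a : ℝ}
    (h : FormApprox p p' a) {V : ℕ → Submodule ℝ D} (hV : Consistent p V) {ε : ℝ} (hε : 0 < ε) :
    ∀ᶠ n in atTop, DiffLe p p' a ε (V n) := by
  filter_upwards [h.eventually_abs_formDiff_le hgraph he hV hε] with n hn g hg
  have := hn g hg g
  rwa [formDiff_self, mul_assoc, ← sq] at this

/-- A property of finite-dimensional spaces that holds eventually along every sequence absorbing the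
chain `F` holds for all spaces above some `F m`. -/
lemma exists_forall_ge_of_forall_seq {F : ℕ → Submodule ℝ D}
    (hfd : ∀ n, FiniteDimensional ℝ (F n)) (hrank : ∀ n, Module.finrank ℝ (F n) = n)
    (hmono : Monotone F) (Good : Submodule ℝ D → Prop)
    (h : ∀ V : ℕ → Submodule ℝ D, (∀ n, FiniteDimensional ℝ (V n)) →
      (∀ n, Module.finrank ℝ (V n) = n) → (∀ m, ∀ᶠ n in atTop, F m ≤ V n) →
      ∀ᶠ n in atTop, Good (V n)) :
    ∃ m, ∀ V : Submodule ℝ D, FiniteDimensional ℝ V → F m ≤ V → Good V := by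
  classical
  by_contra! hcon
  -- Otherwise bad spaces `W m` above `F m` can be put into one sequence, `W m` at the index
  -- `finrank (W m)`. This absorbs the chain, as each index is used at most once.
  choose W hWfd hFW hbad using hcon
  let V : ℕ → Submodule ℝ D := fun n =>
    if hn : ∃ m, Module.finrank ℝ (W m) = n then W hn.choose else F n
  have hVpos : ∀ n (hn : ∃ m, Module.finrank ℝ (W m) = n), V n = W hn.choose := fun n hn =>
    dif_pos hn
  have hVneg : ∀ n, (¬ ∃ m, Module.finrank ℝ (W m) = n) → V n = F n := fun n hn => dif_neg hn
  have hev := h V (fun n => ?_) (fun n => ?_) (fun m => ?_)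
  · obtain ⟨N, hN⟩ := eventually_atTop.1 hev
    have hle : N ≤ Module.finrank ℝ (W N) := by
      have := hWfd N
      exact (hrank N).symm.le.trans (Submodule.finrank_mono (hFW N))
    have hgood := hN _ hle
    rw [hVpos _ ⟨N, rfl⟩] at hgood
    exact hbad _ hgood
  · by_cases hn : ∃ m, Module.finrank ℝ (W m) = n
    · rw [hVpos n hn]; exact hWfd _
    · rw [hVneg n hn]; exact hfd _
  · by_cases hn : ∃ m, Module.finrank ℝ (W m) = n
    · rw [hVpos n hn]; exact hn.choose_spec
    · rw [hVneg n hn]; exact hrank _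
  · have h1 : ∀ᶠ n in atTop, ∀ j ∈ Finset.range m, Module.finrank ℝ (W j) < n :=
      (Finset.eventually_all _).2 fun j _ => eventually_gt_atTop _
    filter_upwards [h1, eventually_ge_atTop m] with n hn hmn
    by_cases hex : ∃ m, Module.finrank ℝ (W m) = n
    · rw [hVpos n hex]
      refine le_trans (hmono ?_) (hFW _)
      by_contra! hlt
      exact (hn _ (Finset.mem_range.2 hlt)).ne hex.choose_spec
    · rw [hVneg n hex]; exact hmono hmn

/-- If `p'` almost preserves the orthogonality between large finite-dimensional spaces and their
complements, then on these complements it is almost a multiple of an isometry. -/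
lemma formEquiv_and_formApprox_of_abs_inner_le
    [CompleteSpace D] [CompleteSpace E] [CompleteSpace E']
    (hgraph : ∀ g, ‖g‖ ≤ ‖p g‖ + ‖p' g‖) (hp : Function.Injective p) (hp' : Function.Injective p')
    (hD : ¬ FiniteDimensional ℝ D)
    (h : ∀ δ : ℝ, 0 < δ → ∃ F : Submodule ℝ D, FiniteDimensional ℝ F ∧
      ∀ V : Submodule ℝ D, FiniteDimensional ℝ V → F ≤ V → ∀ g, PerpTo p V g → ∀ v ∈ V,
        |⟪p' g, p' v⟫_ℝ| ≤ δ * ‖p' g‖ * ‖p' v‖) :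
    FormEquiv p p' ∧ ∃ a, 0 < a ∧ FormApprox p p' a := by
  -- For `u`, `w` of equal norm, `u - w` is perpendicular to `u + w`; hence `‖p' u‖` and `‖p' w‖`
  -- are almost equal.
  have key : ∀ δ : ℝ, 0 < δ → ∃ F : Submodule ℝ D, FiniteDimensional ℝ F ∧
      ∀ u w, PerpTo p F u → PerpTo p F w →
        (1 - δ) * (‖p' u‖ * ‖p w‖) ^ 2 ≤ (1 + δ) * (‖p' w‖ * ‖p u‖) ^ 2 := by
    intro δ hδ
    obtain ⟨F, hF, hFδ⟩ := h δ hδ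
    refine ⟨F, hF, fun u w hu hw => ?_⟩
    set u1 := ‖p w‖ • u
    set w1 := ‖p u‖ • w
    have hu1 : u1 ∈ perpSubmodule p F := Submodule.smul_mem _ _ (mem_perpSubmodule.2 hu)
    have hw1 : w1 ∈ perpSubmodule p F := Submodule.smul_mem _ _ (mem_perpSubmodule.2 hw)
    have hn : ‖p u1‖ = ‖p w1‖ := by
      simp only [u1, w1, map_smul, norm_smul, norm_norm]; ring
    have hperp : ⟪p (u1 - w1), p (u1 + w1)⟫_ℝ = 0 := by
      rw [map_sub, map_add, inner_sub_left, inner_add_right, inner_add_right,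
        real_inner_self_eq_norm_sq, real_inner_self_eq_norm_sq, hn, real_inner_comm]
      ring
    have hall : PerpTo p (F ⊔ Submodule.span ℝ {u1 + w1}) (u1 - w1) := by
      intro v hv
      obtain ⟨f, hf, y, hy, rfl⟩ := Submodule.mem_sup.1 hv
      obtain ⟨t, rfl⟩ := Submodule.mem_span_singleton.1 hy
      rw [map_add, inner_add_right, map_smul, inner_smul_right, hperp,
        mem_perpSubmodule.1 (Submodule.sub_mem _ hu1 hw1) f hf]
      ring
    have h1 := (abs_le.1 (hFδ _ inferInstance le_sup_left _ hall (u1 + w1)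
      (Submodule.mem_sup_right (Submodule.mem_span_singleton_self _)))).2
    have h2 : ⟪p' (u1 - w1), p' (u1 + w1)⟫_ℝ = ‖p' u1‖ ^ 2 - ‖p' w1‖ ^ 2 := by
      rw [map_sub, map_add, inner_sub_left, inner_add_right, inner_add_right,
        real_inner_self_eq_norm_sq, real_inner_self_eq_norm_sq, real_inner_comm]
      ring
    have h3 := parallelogram_law_with_norm ℝ (p' u1) (p' w1)
    rw [← map_add, ← map_sub] at h3
    rw [h2] at h1
    have h4 : δ * ‖p' (u1 - w1)‖ * ‖p' (u1 + w1)‖ ≤ δ * (‖p' u1‖ ^ 2 + ‖p' w1‖ ^ 2) := by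
      rw [mul_assoc]
      refine mul_le_mul_of_nonneg_left ?_ hδ.le
      nlinarith [sq_nonneg (‖p' (u1 - w1)‖ - ‖p' (u1 + w1)‖)]
    have h5 : ‖p' u1‖ = ‖p' u‖ * ‖p w‖ := by
      simp only [u1, map_smul, norm_smul, norm_norm]; ring
    have h6 : ‖p' w1‖ = ‖p' w‖ * ‖p u‖ := by
      simp only [w1, map_smul, norm_smul, norm_norm]; ring
    rw [h5, h6] at h1 h4
    linarith
  have hpos : ∀ {g : D}, g ≠ 0 → 0 < ‖p g‖ := fun hg =>
    norm_pos_iff.2 fun h0 => hg (hp (by rw [h0, map_zero]))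
  have hpos' : ∀ {g : D}, g ≠ 0 → 0 < ‖p' g‖ := fun hg =>
    norm_pos_iff.2 fun h0 => hg (hp' (by rw [h0, map_zero]))
  -- Hence the squared ratio `r g` of the norms is, up to factors `κ` close to `1`, constant.
  let r : D → ℝ := fun g => (‖p' g‖ / ‖p g‖) ^ 2
  have hr : ∀ {g : D}, g ≠ 0 → 0 < r g := fun hg => pow_pos (div_pos (hpos' hg) (hpos hg)) 2
  have key2 : ∀ κ : ℝ, 1 < κ → ∃ F : Submodule ℝ D, FiniteDimensional ℝ F ∧
      ∀ u w, PerpTo p F u → PerpTo p F w → u ≠ 0 → w ≠ 0 → r u ≤ κ * r w := by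
    intro κ hκ
    obtain ⟨F, hF, h1⟩ := key ((κ - 1) / (κ + 1)) (div_pos (by linarith) (by linarith))
    refine ⟨F, hF, fun u w hu hw hu0 hw0 => ?_⟩
    have h2 := h1 u w hu hw
    have h3 : 1 - (κ - 1) / (κ + 1) = 2 / (κ + 1) := by field_simp; ring
    have h4 : 1 + (κ - 1) / (κ + 1) = 2 / (κ + 1) * κ := by field_simp; ring
    rw [h3, h4, mul_assoc] at h2
    have h5 := le_of_mul_le_mul_left h2 (by positivity)
    simp only [r]
    rw [div_pow, div_pow, ← mul_div_assoc, div_le_div_iff₀ (pow_pos (hpos hu0) 2)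
      (pow_pos (hpos hw0) 2)]
    nlinarith
  -- The constant `a` is the supremum of lower bounds for `r` along a sequence of factors `κ → 1`.
  have hκ : ∀ n : ℕ, (1 : ℝ) < 1 + 1 / (n + 1) := fun n => by
    have : (0 : ℝ) < 1 / (n + 1) := by positivity
    linarith
  choose F hF hFr using fun n : ℕ => key2 (1 + 1 / (n + 1)) (hκ n)
  choose u hu0 hu using fun n => exists_perpTo_ne_zero p hD (F n)
  let l : ℕ → ℝ := fun n => r (u n) / (1 + 1 / (n + 1))
  have hl : ∀ m n w, w ≠ 0 → PerpTo p (F n) w → l m ≤ (1 + 1 / (n + 1)) * r w := by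
    intro m n w hw0 hw
    obtain ⟨z, hz0, hz⟩ := exists_perpTo_ne_zero p hD (F m ⊔ F n)
    have h1 := hFr m (u m) z (hu m) (hz.mono le_sup_left) (hu0 m) hz0
    have h2 := hFr n z w (hz.mono le_sup_right) hw hz0 hw0
    refine le_trans ?_ h2
    simp only [l]
    rwa [div_le_iff₀ (by linarith [hκ m]), mul_comm]
  have hbdd : BddAbove (Set.range l) := ⟨_, by
    rintro _ ⟨m, rfl⟩; exact hl m 0 (u 0) (hu0 0) (hu 0)⟩
  let a := ⨆ n, l n
  have ha : 0 < a := lt_of_lt_of_le (div_pos (hr (hu0 0)) (by linarith [hκ 0])) (le_ciSup hbdd 0)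
  have hupper : ∀ n w, w ≠ 0 → PerpTo p (F n) w → a ≤ (1 + 1 / (n + 1)) * r w := fun n w hw0 hw =>
    ciSup_le fun m => hl m n w hw0 hw
  have hlower : ∀ n w, w ≠ 0 → PerpTo p (F n) w →
      r w ≤ (1 + 1 / (n + 1)) * ((1 + 1 / (n + 1)) * a) := by
    intro n w hw0 hw
    refine (hFr n w (u n) hw (hu n) hw0 (hu0 n)).trans ?_
    have h1 : r (u n) = (1 + 1 / (n + 1)) * l n := by
      simp only [l]; rw [mul_div_cancel₀]; linarith [hκ n]
    rw [h1]
    have := le_ciSup hbdd n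
    have := hκ n
    gcongr
  have hrp : ∀ w, w ≠ 0 → ‖p' w‖ ^ 2 = r w * ‖p w‖ ^ 2 := fun w hw0 => by
    simp only [r]; rw [div_pow, div_mul_cancel₀]; exact (pow_pos (hpos hw0) 2).ne'
  have hsq : ∀ {x y : ℝ}, 0 < y → x = y ^ 2 → √x = y := fun hy hx => by
    rw [hx, Real.sqrt_sq hy.le]
  refine ⟨formEquiv_of_perp hgraph hp hp' (F 0) (c := √(a / 2)) (C := √(4 * a))
    (by positivity) fun g hg => ?_, a, ha, fun ε hε => ?_⟩
  · rcases eq_or_ne g 0 with rfl | hg0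
    · simp
    have h1 := hupper 0 g hg0 hg
    have h2 := hlower 0 g hg0 hg
    norm_num at h1 h2
    have h3 := hrp g hg0
    constructor
    · refine le_of_sq_le_sq ?_ (norm_nonneg _)
      rw [mul_pow, Real.sq_sqrt (by positivity), h3]
      gcongr
      linarith
    · refine le_of_sq_le_sq ?_ (by positivity)
      rw [mul_pow, Real.sq_sqrt (by positivity), h3]
      gcongr
      linarith
  · obtain ⟨n, hn⟩ := exists_nat_one_div_lt (show 0 < ε / (3 * a) by positivity)
    refine ⟨F n, hF n, fun g hg => ?_⟩
    rcases eq_or_ne g 0 with rfl | hg0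
    · simp
    have h1 := hupper n g hg0 hg
    have h2 := hlower n g hg0 hg
    set x : ℝ := 1 / (n + 1)
    have hx0 : 0 < x := by positivity
    have hx1 : x ≤ 1 := by
      simp only [x]; rw [div_le_one (by positivity)]; linarith [n.cast_nonneg (α := ℝ)]
    have hx2 : x * (3 * a) < ε := (lt_div_iff₀ (by positivity)).1 hn
    have h3 : (1 + x) * ((1 + x) * a) ≤ a + 3 * x * a := by
      have : (1 + x) * ((1 + x) * a) = a + (2 + x) * x * a := by ring
      rw [this]; gcongr; linarith
    have h4 : |r g - a| ≤ ε := by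
      rw [abs_le]
      refine ⟨?_, by linarith⟩
      have h5 : x * r g ≤ x * (a + 3 * x * a) := by gcongr; linarith
      have h6 : r g ≤ a → x * r g ≤ x * a := fun h => by gcongr
      by_cases hra : r g ≤ a
      · have := h6 hra
        have : 0 < x * a := by positivity
        linarith
      · push Not at hra; linarith
    rw [hrp g hg0, ← sub_mul, abs_mul, abs_of_nonneg (sq_nonneg ‖p g‖)]
    gcongr

lemma FormApprox.formEquiv [CompleteSpace D] [CompleteSpace E] [CompleteSpace E']
    (hgraph : ∀ g, ‖g‖ ≤ ‖p g‖ + ‖p' g‖) (hp : Function.Injective p) (hp' : Function.Injective p')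
    {a : ℝ} (ha : 0 < a) (h : FormApprox p p' a) : FormEquiv p p' := by
  obtain ⟨V, hV, hVa⟩ := h (a / 2) (by positivity)
  refine formEquiv_of_perp hgraph hp hp' V (c := √(a / 2)) (C := √(2 * a)) (by positivity)
    fun g hg => ?_
  have h1 := abs_le.1 (hVa g hg)
  constructor
  · refine le_of_sq_le_sq ?_ (norm_nonneg _)
    rw [mul_pow, Real.sq_sqrt (by positivity)]
    linarith
  · refine le_of_sq_le_sq ?_ (by positivity)
    rw [mul_pow, Real.sq_sqrt (by positivity)]
    nlinarith [sq_nonneg ‖p g‖]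

/-- If `g` and `g'` are the errors of the predictions of one element from `V`, best in the first
and in the second form, then in the first form the square of the second error is at most `1 + ε`
times the square of the first one. -/
def RatioLe (p : D →L[ℝ] E) (p' : D →L[ℝ] E') (ε : ℝ) (V : Submodule ℝ D) : Prop :=
  ∀ g g', PerpTo p V g → PerpTo p' V g' → g - g' ∈ V →
    ‖p g'‖ ^ 2 ≤ (1 + ε) * ‖p g‖ ^ 2

lemma norm_sq_eq_of_sub_mem {V : Submodule ℝ D} {g g' : D} (hg : PerpTo p V g)
    (hgg : g - g' ∈ V) : ‖p g'‖ ^ 2 = ‖p g‖ ^ 2 + ‖p (g - g')‖ ^ 2 := by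
  have := hg.norm_add_sq (Submodule.neg_mem _ hgg)
  rwa [neg_sub, add_sub_cancel, ← neg_sub g g', map_neg, norm_neg] at this

lemma inner_eq_of_sub_mem {V : Submodule ℝ D} {g g' v : D} (hg : PerpTo p V g)
    (hv : v ∈ V) : ⟪p g', p v⟫_ℝ = -⟪p (g - g'), p v⟫_ℝ := by
  rw [map_sub, inner_sub_left, hg v hv]; ring

/-- A small angle between `V` and its complement under the other form makes the ratio of the
errors close to one. -/
lemma RatioLe.of_abs_inner_le {δ ε : ℝ} (hδ0 : 0 ≤ δ) (hδ : 1 ≤ (1 + ε) * (1 - δ ^ 2))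
    (hε : 0 ≤ ε) {V : Submodule ℝ D}
    (h : ∀ g', PerpTo p' V g' → ∀ v ∈ V, |⟪p g', p v⟫_ℝ| ≤ δ * ‖p g'‖ * ‖p v‖) :
    RatioLe p p' ε V := by
  intro g g' hg hg' hgg
  have h1 := h g' hg' _ hgg
  rw [inner_eq_of_sub_mem hg hgg, abs_neg, real_inner_self_eq_norm_mul_norm,
    abs_of_nonneg (by positivity)] at h1
  have h2 : ‖p (g - g')‖ ≤ δ * ‖p g'‖ := by
    rcases (norm_nonneg (p (g - g'))).eq_or_lt with h0 | h0
    · rw [← h0]; positivity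
    · exact le_of_mul_le_mul_right h1 h0
  have h3 := norm_sq_eq_of_sub_mem hg hgg
  have h4 : ‖p (g - g')‖ ^ 2 ≤ δ ^ 2 * ‖p g'‖ ^ 2 := by
    rw [← mul_pow]; exact pow_le_pow_left₀ (norm_nonneg _) h2 2
  have h5 : (1 - δ ^ 2) * ‖p g'‖ ^ 2 ≤ ‖p g‖ ^ 2 := by linarith
  calc ‖p g'‖ ^ 2 = 1 * ‖p g'‖ ^ 2 := (one_mul _).symm
    _ ≤ ((1 + ε) * (1 - δ ^ 2)) * ‖p g'‖ ^ 2 := by gcongr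
    _ = (1 + ε) * ((1 - δ ^ 2) * ‖p g'‖ ^ 2) := by ring
    _ ≤ (1 + ε) * ‖p g‖ ^ 2 := by gcongr

/-- Ratios of the errors close to one force a small angle between `V` and its complement under the
other form. -/
lemma RatioLe.abs_inner_le {δ : ℝ} (hδ : 0 ≤ δ) {V : Submodule ℝ D} [FiniteDimensional ℝ V]
    (h : RatioLe p p' (δ ^ 2) V) {g' : D} (hg' : PerpTo p' V g') {v : D} (hv : v ∈ V) :
    |⟪p g', p v⟫_ℝ| ≤ δ * ‖p g'‖ * ‖p v‖ := by
  obtain ⟨u, hu, hg⟩ := exists_perpTo_sub p V g'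
  have hmem : g' - u - g' ∈ V := by
    rw [sub_sub_cancel_left]; exact Submodule.neg_mem _ hu
  have h1 := h _ _ hg hg' hmem
  have h3 := norm_sq_eq_of_sub_mem hg hmem
  rw [inner_eq_of_sub_mem hg hv, abs_neg]
  refine (abs_real_inner_le_norm _ _).trans ?_
  refine mul_le_mul_of_nonneg_right ?_ (norm_nonneg _)
  refine le_of_sq_le_sq ?_ (by positivity)
  rw [mul_pow]
  nlinarith [sq_nonneg δ, sq_nonneg ‖p (g' - u - g')‖]

/-- If `g'` is perpendicular to `V n` in the form of `p'`, then its product with `v ∈ V n` in the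
form of `p` is a value of `formDiff`, which is small. -/
lemma FormApprox.eventually_ratioLe [CompleteSpace D] [CompleteSpace E']
    (hgraph : ∀ g, ‖g‖ ≤ ‖p' g‖ + ‖p g‖) (he : FormEquiv p' p) {a : ℝ}
    (h : FormApprox p' p a) {V : ℕ → Submodule ℝ D} (hV : Consistent p' V) {ε : ℝ} (hε : 0 < ε) :
    ∀ᶠ n in atTop, RatioLe p p' ε (V n) := by
  obtain ⟨k, K, hk, hK, hkK⟩ := id he
  obtain ⟨δ, hδ0, hδ1⟩ : ∃ δ : ℝ, 0 < δ ∧ 1 ≤ (1 + ε) * (1 - δ ^ 2) := by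
    refine ⟨√(ε / (1 + ε)), by positivity, ?_⟩
    rw [Real.sq_sqrt (by positivity)]
    field_simp
    linarith
  filter_upwards [h.eventually_abs_formDiff_le hgraph he hV (ε := δ * k ^ 2) (by positivity)]
    with n hn
  refine RatioLe.of_abs_inner_le hδ0.le hδ1 hε.le fun g' hg' v hv => ?_
  have h1 := hn g' hg' v
  rw [formDiff_apply, hg' v hv, mul_zero, sub_zero] at h1
  refine h1.trans ?_
  have h2 := mul_le_mul (hkK g').1 (hkK v).1 (by positivity) (norm_nonneg _)
  have h3 := mul_le_mul_of_nonneg_left h2 hδ0.le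
  linarith

end Forms

/-! ### Square roots and compactness of operators on real Hilbert spaces -/

section HilbertOperators

variable {E : Type*} [NormedAddCommGroup E] [InnerProductSpace ℝ E]

/-- The bilinear form `⟪A x, y⟫`. -/
noncomputable def opForm (A : E →L[ℝ] E) : E →ₗ[ℝ] E →ₗ[ℝ] ℝ :=
  (innerₗ E).comp (A : E →ₗ[ℝ] E)

lemma opForm_apply (A : E →L[ℝ] E) (x y : E) : opForm A x y = ⟪A x, y⟫_ℝ := rfl

lemma abs_inner_le_of_abs_inner_self_le (A : E →L[ℝ] E) (hA : (A : E →ₗ[ℝ] E).IsSymmetric)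
    (W : Submodule ℝ E) {ε : ℝ} (hε : 0 ≤ ε)
    (h : ∀ x ∈ W, |⟪A x, x⟫_ℝ| ≤ ε * ‖x‖ ^ 2) {x y : E} (hx : x ∈ W) (hy : y ∈ W) :
    |⟪A x, y⟫_ℝ| ≤ ε * ‖x‖ * ‖y‖ :=
  abs_apply_le_of_abs_apply_self_le (opForm A)
    (fun g h => by rw [opForm_apply, opForm_apply, real_inner_comm]; exact (hA h g).symm)
    (ContinuousLinearMap.id ℝ E) W hε h hx hy

lemma norm_le_of_abs_inner_self_le (A : E →L[ℝ] E) (hA : (A : E →ₗ[ℝ] E).IsSymmetric)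
    {ε : ℝ} (hε : 0 ≤ ε) (h : ∀ x, |⟪A x, x⟫_ℝ| ≤ ε * ‖x‖ ^ 2) : ‖A‖ ≤ ε := by
  refine A.opNorm_le_bound hε fun x => ?_
  have h1 := (abs_le.1 (abs_inner_le_of_abs_inner_self_le A hA ⊤ hε (fun x _ => h x)
    (Submodule.mem_top (x := x)) (Submodule.mem_top (x := A x)))).2
  rw [real_inner_self_eq_norm_mul_norm] at h1
  rcases (norm_nonneg (A x)).eq_or_lt with h0 | h0
  · rw [← h0]; positivity
  · exact le_of_mul_le_mul_right h1 h0

/-- The iteration `Y ↦ (B + Y²) / 2`, started at `0`. A limit `Y` satisfies `(1 - Y)² = 1 - B`. -/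
noncomputable def sqrtIter {A : Type*} [NormedRing A] [NormedAlgebra ℝ A] (B : A) : ℕ → A
  | 0 => 0
  | n + 1 => (1 / 2 : ℝ) • (B + sqrtIter B n * sqrtIter B n)

/-- For the scalar `1` the iteration increases in `[0, 1]`. It dominates, in norm, the iterations
for all operators of norm at most `1`, and hence their increments are summable. -/
lemma sqrtIter_real (n : ℕ) : 0 ≤ sqrtIter (1 : ℝ) n ∧ sqrtIter (1 : ℝ) n ≤ 1 ∧
    sqrtIter (1 : ℝ) n ≤ sqrtIter (1 : ℝ) (n + 1) := by
  have h : ∀ n, sqrtIter (1 : ℝ) (n + 1) = (1 + sqrtIter (1 : ℝ) n * sqrtIter (1 : ℝ) n) / 2 :=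
    fun n => by simp [sqrtIter]; ring
  induction n with
  | zero => rw [h]; simp [sqrtIter]
  | succ n ih =>
    obtain ⟨h0, h1, h2⟩ := ih
    rw [h (n + 1)]
    have := h n
    refine ⟨by nlinarith, by nlinarith, by nlinarith [sq_nonneg (sqrtIter (1 : ℝ) (n + 1) - 1)]⟩

lemma norm_sqrtIter_le (B : E →L[ℝ] E) (hB : ‖B‖ ≤ 1) (n : ℕ) :
    ‖sqrtIter B n‖ ≤ sqrtIter (1 : ℝ) n := by
  induction n with
  | zero => simp [sqrtIter]
  | succ n ih =>
    simp only [sqrtIter]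
    rw [norm_smul, smul_eq_mul]
    norm_num
    have h1 := norm_add_le B (sqrtIter B n * sqrtIter B n)
    have h2 := norm_mul_le (sqrtIter B n) (sqrtIter B n)
    have h3 := mul_le_mul ih ih (norm_nonneg _) (sqrtIter_real n).1
    linarith

lemma sqrtIter_mem_adjoin (B : E →L[ℝ] E) (n : ℕ) :
    sqrtIter B n ∈ Algebra.adjoin ℝ {B} := by
  induction n with
  | zero => exact zero_mem _
  | succ n ih =>
    exact Subalgebra.smul_mem _ (add_mem (Algebra.self_mem_adjoin_singleton ℝ B) (mul_mem ih ih)) _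

lemma norm_sqrtIter_sub_le (B : E →L[ℝ] E) (hB : ‖B‖ ≤ 1) (n : ℕ) :
    ‖sqrtIter B (n + 1) - sqrtIter B n‖ ≤ sqrtIter (1 : ℝ) (n + 1) - sqrtIter (1 : ℝ) n := by
  induction n with
  | zero => simpa [sqrtIter, norm_smul] using hB
  | succ n ih =>
    have hcomm : Commute (sqrtIter B (n + 1)) (sqrtIter B n) :=
      Algebra.commute_of_mem_adjoin_singleton_of_commute (sqrtIter_mem_adjoin B _)
        (Algebra.commute_of_mem_adjoin_self (sqrtIter_mem_adjoin B _)).symm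
    have h1 : sqrtIter B (n + 1 + 1) - sqrtIter B (n + 1) = (1 / 2 : ℝ) •
        ((sqrtIter B (n + 1) + sqrtIter B n) * (sqrtIter B (n + 1) - sqrtIter B n)) := by
      rw [← hcomm.mul_self_sub_mul_self_eq, sqrtIter, sqrtIter, ← smul_sub]
      congr 1
      abel
    have h2 : sqrtIter (1 : ℝ) (n + 1 + 1) - sqrtIter (1 : ℝ) (n + 1) = (1 / 2 : ℝ) *
        ((sqrtIter (1 : ℝ) (n + 1) + sqrtIter (1 : ℝ) n) *
          (sqrtIter (1 : ℝ) (n + 1) - sqrtIter (1 : ℝ) n)) := by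
      simp only [sqrtIter, smul_eq_mul]; ring
    rw [h1, h2, norm_smul]
    norm_num
    refine (norm_mul_le _ _).trans (mul_le_mul ?_ ih (norm_nonneg _) ?_)
    · exact (norm_add_le _ _).trans
        (add_le_add (norm_sqrtIter_le B hB _) (norm_sqrtIter_le B hB _))
    · exact add_nonneg (sqrtIter_real _).1 (sqrtIter_real _).1

/-- Every positive operator on a real Hilbert space has a positive square root. -/
lemma exists_isPositive_comp_self_eq [CompleteSpace E] (A : E →L[ℝ] E) (hA : A.IsPositive) :
    ∃ S : E →L[ℝ] E, S.IsPositive ∧ S ∘L S = A := by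
  rcases eq_or_ne A 0 with rfl | hA0
  · exact ⟨0, ContinuousLinearMap.isPositive_zero, by simp⟩
  have hc : 0 < ‖A‖ := norm_pos_iff.2 hA0
  set B : E →L[ℝ] E := 1 - ‖A‖⁻¹ • A
  have hBsymm : (B : E →ₗ[ℝ] E).IsSymmetric := by
    intro x y
    have := hA.isSymmetric x y
    simp only [ContinuousLinearMap.coe_coe] at this ⊢
    simp only [B, sub_apply, one_apply_eq_self,
      smul_apply, inner_sub_left, inner_sub_right, inner_smul_left,
      inner_smul_right, this]
    simp
  have hB : ‖B‖ ≤ 1 := by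
    refine norm_le_of_abs_inner_self_le B hBsymm zero_le_one fun x => ?_
    have h1 : ⟪B x, x⟫_ℝ = ‖x‖ ^ 2 - ‖A‖⁻¹ * ⟪A x, x⟫_ℝ := by
      simp [B, inner_sub_left, inner_smul_left]
    have h2 : 0 ≤ ‖A‖⁻¹ * ⟪A x, x⟫_ℝ := mul_nonneg (by positivity) (hA.inner_nonneg_left x)
    have h3 : ‖A‖⁻¹ * ⟪A x, x⟫_ℝ ≤ ‖x‖ ^ 2 := by
      rw [inv_mul_le_iff₀ hc]
      refine (real_inner_le_norm _ _).trans ?_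
      nlinarith [A.le_opNorm x, norm_nonneg x]
    rw [h1, abs_le]
    constructor <;> nlinarith
  have hmono : Monotone (sqrtIter (1 : ℝ)) := monotone_nat_of_le_succ fun n => (sqrtIter_real n).2.2
  have hscal : CauchySeq (sqrtIter (1 : ℝ)) :=
    (tendsto_atTop_ciSup hmono ⟨1, by rintro _ ⟨n, rfl⟩; exact (sqrtIter_real n).2.1⟩).cauchySeq
  have hle : ∀ m n, m ≤ n → ‖sqrtIter B n - sqrtIter B m‖ ≤ sqrtIter (1 : ℝ) n - sqrtIter 1 m := by
    intro m n hmn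
    induction n, hmn using Nat.le_induction with
    | base => simp
    | succ n _ ih =>
      rw [← sub_add_sub_cancel _ (sqrtIter B n), ← sub_add_sub_cancel _ (sqrtIter (1 : ℝ) n)]
      exact (norm_add_le _ _).trans (add_le_add (norm_sqrtIter_sub_le B hB n) ih)
  have hcauchy : CauchySeq (sqrtIter B) := by
    rw [Metric.cauchySeq_iff'] at hscal ⊢
    intro ε hε
    obtain ⟨N, hN⟩ := hscal ε hε
    refine ⟨N, fun n hn => ?_⟩
    rw [dist_eq_norm]
    exact (hle N n hn).trans_lt ((le_abs_self _).trans_lt (hN n hn))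
  obtain ⟨Y, hY⟩ := cauchySeq_tendsto_of_complete hcauchy
  have hYeq : Y = (1 / 2 : ℝ) • (B + Y * Y) :=
    tendsto_nhds_unique ((tendsto_add_atTop_iff_nat 1).2 hY)
      ((tendsto_const_nhds.add (hY.mul hY)).const_smul (1 / 2 : ℝ))
  have hYnorm : ‖Y‖ ≤ 1 := le_of_tendsto hY.norm
    (Eventually.of_forall fun n => (norm_sqrtIter_le B hB n).trans (sqrtIter_real n).2.1)
  have hiter : ∀ n x y, ⟪sqrtIter B n x, y⟫_ℝ = ⟪x, sqrtIter B n y⟫_ℝ := by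
    intro n
    induction n with
    | zero => simp [sqrtIter]
    | succ n ih =>
      intro x y
      have := hBsymm x y
      simp only [ContinuousLinearMap.coe_coe] at this
      simp only [sqrtIter, smul_apply, add_apply,
        inner_smul_left, inner_smul_right, inner_add_left, inner_add_right, this,
        mul_apply_eq_comp, ih]
      simp
  have hYsymm : ∀ x y, ⟪Y x, y⟫_ℝ = ⟪x, Y y⟫_ℝ := by
    intro x y
    have hpt : ∀ x, Tendsto (fun n => sqrtIter B n x) atTop (𝓝 (Y x)) := fun x =>
      ((ContinuousLinearMap.apply ℝ E x).continuous.tendsto Y).comp hY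
    refine tendsto_nhds_unique ((hpt x).inner tendsto_const_nhds) ?_
    simp only [hiter]
    exact tendsto_const_nhds.inner (hpt y)
  -- `1 - Y` is the root of `1 - B`.
  have hsq : (1 - Y) * (1 - Y) = ‖A‖⁻¹ • A := by
    have h1 : (2 : ℝ) • Y = B + Y * Y := by
      conv_lhs => rw [hYeq]
      rw [smul_smul]; norm_num
    have h2 : (1 - Y) * (1 - Y) = 1 - (2 : ℝ) • Y + Y * Y := by
      rw [two_smul]; noncomm_ring
    rw [h2, h1]
    simp only [B]
    abel
  refine ⟨√‖A‖ • (1 - Y), ?_, ?_⟩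
  · rw [ContinuousLinearMap.isPositive_iff']
    refine ⟨?_, fun x => ?_⟩
    · rw [ContinuousLinearMap.isSelfAdjoint_iff_isSymmetric]
      intro x y
      simp only [ContinuousLinearMap.coe_coe, smul_apply,
        sub_apply, one_apply_eq_self, inner_smul_left,
        inner_smul_right, inner_sub_left, inner_sub_right, hYsymm]
      simp
    · simp only [smul_apply, sub_apply,
        one_apply_eq_self, inner_smul_left, inner_sub_left,
        real_inner_self_eq_norm_sq]
      refine mul_nonneg (by simp) ?_
      have h1 := real_inner_le_norm (Y x) x
      have h2 := Y.le_of_opNorm_le hYnorm x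
      nlinarith [norm_nonneg x]
  · have : (√‖A‖ • (1 - Y)) ∘L (√‖A‖ • (1 - Y)) = (√‖A‖ * √‖A‖) • ((1 - Y) * (1 - Y)) :=
      smul_mul_smul_comm _ _ _ _
    rw [this, hsq, Real.mul_self_sqrt (norm_nonneg _), smul_smul, mul_inv_cancel₀ hc.ne', one_smul]

lemma opSqrt_spec [CompleteSpace E] {A : E →L[ℝ] E} (hA : A.IsPositive) :
    (opSqrt A).IsPositive ∧ opSqrt A ∘L opSqrt A = A :=
  Classical.epsilon_spec (exists_isPositive_comp_self_eq A hA)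

/-- The span of an `ε`-net of the image of the unit ball is as required. -/
lemma exists_abs_inner_le_of_isCompactOperator {A : E →L[ℝ] E} (hA : IsCompactOperator A)
    {ε : ℝ} (hε : 0 < ε) : ∃ F : Submodule ℝ E, FiniteDimensional ℝ F ∧
      ∀ x ∈ Fᗮ, |⟪A x, x⟫_ℝ| ≤ ε * ‖x‖ ^ 2 := by
  have hcomp := hA.isCompact_closure_image_closedBall (1 : ℝ)
  obtain ⟨t, ht, hcov⟩ := Metric.totallyBounded_iff.1
    (hcomp.totallyBounded.subset subset_closure) ε hε
  refine ⟨Submodule.span ℝ t, FiniteDimensional.span_of_finite ℝ ht, fun x hx => ?_⟩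
  rcases eq_or_ne x 0 with rfl | hx0
  · simp
  have hn : 0 < ‖x‖ := norm_pos_iff.2 hx0
  set y := ‖x‖⁻¹ • x
  have hy : ‖y‖ = 1 := by simp [y, norm_smul, hn.ne']
  have hyF : y ∈ (Submodule.span ℝ t)ᗮ := Submodule.smul_mem _ _ hx
  obtain ⟨f, hf, hfy⟩ := Set.mem_iUnion₂.1 (hcov ⟨y, by simp [hy], rfl⟩)
  have h1 : ⟪A y, y⟫_ℝ = ⟪A y - f, y⟫_ℝ := by
    rw [inner_sub_left, (Submodule.mem_orthogonal _ _).1 hyF f (Submodule.subset_span hf), sub_zero]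
  have h2 : |⟪A y, y⟫_ℝ| ≤ ε := by
    rw [h1]
    refine (abs_real_inner_le_norm _ _).trans ?_
    rw [hy, mul_one, ← dist_eq_norm]
    exact (Metric.mem_ball.1 hfy).le
  have h3 : x = ‖x‖ • y := by simp [y, smul_smul, hn.ne']
  have h4 : ⟪A x, x⟫_ℝ = ‖x‖ ^ 2 * ⟪A y, y⟫_ℝ := by
    rw [h3]
    simp only [map_smul, inner_smul_left, inner_smul_right, norm_smul, norm_norm, hy]
    simp; ring
  rw [h4, abs_mul, abs_of_pos (by positivity), mul_comm]
  gcongr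

/-- With the projections `P` onto `F` and `Q = 1 - P`, the operator `A - Q A Q` has finite rank and
`Q A Q` has norm at most `ε`. -/
lemma isCompactOperator_of_abs_inner_le [CompleteSpace E] {A : E →L[ℝ] E}
    (hA : (A : E →ₗ[ℝ] E).IsSymmetric)
    (h : ∀ ε : ℝ, 0 < ε → ∃ F : Submodule ℝ E, FiniteDimensional ℝ F ∧
      ∀ x ∈ Fᗮ, |⟪A x, x⟫_ℝ| ≤ ε * ‖x‖ ^ 2) : IsCompactOperator A := by
  have hcl : IsClosed {A : E →L[ℝ] E | IsCompactOperator A} := isClosed_setOfPred_isCompactOperator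
  refine hcl.closure_subset (Metric.mem_closure_iff.2 fun ε hε => ?_)
  obtain ⟨F, hF, hFε⟩ := h (ε / 2) (by positivity)
  let P : E →L[ℝ] E := F.starProjection
  let Q : E →L[ℝ] E := Fᗮ.starProjection
  have hPQ : ∀ x, x = P x + Q x := fun x => by
    simp only [P, Q]; rw [Submodule.starProjection_orthogonal]; simp
  have hPc : IsCompactOperator P := by
    have : IsCompactOperator (F.orthogonalProjectionOnto : E →L[ℝ] F) :=
      isCompactOperator_of_locallyCompactSpace_dom (F.orthogonalProjectionOnto)
    exact this.clm_comp F.subtypeL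
  refine ⟨A ∘L P + P ∘L A ∘L Q, ?_, ?_⟩
  · exact (hPc.clm_comp A).add (hPc.comp_clm (A ∘L Q))
  · have hdiff : A - (A ∘L P + P ∘L A ∘L Q) = Q ∘L A ∘L Q := by
      ext x
      have h1 : A x = A (P x) + A (Q x) := by rw [← map_add, ← hPQ]
      have h2 := hPQ (A (Q x))
      simp only [sub_apply, add_apply,
        ContinuousLinearMap.comp_apply]
      rw [h1, sub_eq_iff_eq_add]
      nth_rw 1 [h2]
      abel
    have hQsymm : ∀ x y, ⟪Q x, y⟫_ℝ = ⟪x, Q y⟫_ℝ := fun x y =>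
      Submodule.inner_starProjection_left_eq_right _ x y
    rw [dist_eq_norm, hdiff]
    refine lt_of_le_of_lt (norm_le_of_abs_inner_self_le _ ?_ (half_pos hε).le fun x => ?_)
      (half_lt_self hε)
    · intro x y
      have := hA (Q x) (Q y)
      simp only [ContinuousLinearMap.coe_coe] at this ⊢
      simp only [ContinuousLinearMap.comp_apply, hQsymm, this]
    · have h1 := hFε (Q x) (Submodule.starProjection_apply_mem _ _)
      have h2 : ‖Q x‖ ≤ ‖x‖ := Submodule.norm_starProjection_apply_le _ x
      simp only [ContinuousLinearMap.comp_apply]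
      rw [hQsymm]
      exact h1.trans (by gcongr)

end HilbertOperators

/-! ### The Cameron–Martin space of a Gaussian model -/

namespace GaussianModel

section OneModel

variable {X : Type*} [MetricSpace X] [CompactSpace X] [MeasurableSpace X] [BorelSpace X]
variable {ν : Measure X} [IsFiniteMeasure ν]
variable {Ω : Type*} [MeasurableSpace Ω] {P : Measure Ω} [IsProbabilityMeasure P]

lemma inner_Z0 (M : GaussianModel ν P) (x y : X) : ⟪M.Z0 x, M.Z0 y⟫_ℝ = M.cov (x, y) := by
  rw [← M.covariance_eq, L2.inner_def]
  refine integral_congr_ae ?_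
  filter_upwards [(M.memLp_centered x).coeFn_toLp, (M.memLp_centered y).coeFn_toLp] with ω hx hy
  simp only [Z0, hx, hy]
  simp [mul_comm]

lemma continuous_Z0 (M : GaussianModel ν P) : Continuous M.Z0 := by
  rw [continuous_iff_continuousAt]
  intro x
  rw [ContinuousAt, tendsto_iff_norm_sub_tendsto_zero]
  have h1 : ∀ y, ‖M.Z0 y - M.Z0 x‖ = √(M.cov (y, y) - 2 * M.cov (y, x) + M.cov (x, x)) := by
    intro y
    rw [← inner_Z0, ← inner_Z0, ← inner_Z0, real_inner_self_eq_norm_sq, real_inner_self_eq_norm_sq,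
      ← norm_sub_sq_real, Real.sqrt_sq (norm_nonneg _)]
  simp only [h1]
  have h2 : Continuous fun y => √(M.cov (y, y) - 2 * M.cov (y, x) + M.cov (x, x)) := by
    fun_prop
  convert h2.tendsto x using 2
  rw [eq_comm, Real.sqrt_eq_zero_of_nonpos]
  linarith

/-- The function `x ↦ ⟪Z⁰(x), h⟫`, an element of the Cameron--Martin space of the model. -/
noncomputable def eval (M : GaussianModel ν P) : Lp ℝ 2 P →L[ℝ] C(X, ℝ) :=
  LinearMap.mkContinuous
    { toFun := fun h => ⟨fun x => ⟪M.Z0 x, h⟫_ℝ, M.continuous_Z0.inner continuous_const⟩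
      map_add' := fun h h' => by ext x; simp [inner_add_right]
      map_smul' := fun c h => by ext x; simp [inner_smul_right] }
    ‖(⟨M.Z0, M.continuous_Z0⟩ : C(X, Lp ℝ 2 P))‖
    fun h => by
      refine (ContinuousMap.norm_le _ (by positivity)).2 fun x => ?_
      refine (abs_real_inner_le_norm (M.Z0 x) h).trans
        (mul_le_mul_of_nonneg_right ?_ (norm_nonneg h))
      exact (⟨M.Z0, M.continuous_Z0⟩ : C(X, Lp ℝ 2 P)).norm_coe_le_norm x

lemma eval_apply (M : GaussianModel ν P) (h : Lp ℝ 2 P) (x : X) :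
    M.eval h x = ⟪M.Z0 x, h⟫_ℝ := rfl

/-- The function `x ↦ ⟪Z⁰(x), h⟫` as an element of `L₂(X, ν)`. -/
noncomputable def evalL (M : GaussianModel ν P) : Lp ℝ 2 P →L[ℝ] Lp ℝ 2 ν :=
  (ContinuousMap.toLp 2 ν ℝ).comp M.eval

/-- The adjoint of `evalL`: the observable `∫ w(x) Z⁰(x) dν(x)`. -/
noncomputable def observe (M : GaussianModel ν P) : Lp ℝ 2 ν →L[ℝ] Lp ℝ 2 P :=
  ContinuousLinearMap.adjoint M.evalL

lemma inner_observe (M : GaussianModel ν P) (w : Lp ℝ 2 ν) (h : Lp ℝ 2 P) :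
    ⟪M.observe w, h⟫_ℝ = ⟪w, M.evalL h⟫_ℝ :=
  ContinuousLinearMap.adjoint_inner_left _ _ _

lemma evalL_observe (M : GaussianModel ν P) (w : Lp ℝ 2 ν) : M.evalL (M.observe w) = M.C w := by
  apply Lp.ext
  refine (ContinuousMap.coeFn_toLp ν (M.eval (M.observe w))).trans ?_
  refine EventuallyEq.trans (Eventually.of_forall fun x => ?_)
    (memLp_kernelFun M.cov w).coeFn_toLp.symm
  rw [eval_apply, real_inner_comm, inner_observe, L2.inner_def, kernelFun]
  refine integral_congr_ae ?_
  filter_upwards [ContinuousMap.coeFn_toLp (p := 2) (𝕜 := ℝ) ν (M.eval (M.Z0 x))] with y hy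
  have : M.evalL (M.Z0 x) y = M.cov (x, y) := by
    rw [← inner_Z0, real_inner_comm, ← eval_apply, ← hy]; rfl
  rw [this]
  rfl

lemma C_isPositive (M : GaussianModel ν P) : M.C.IsPositive := by
  have : M.C = M.evalL ∘L ContinuousLinearMap.adjoint M.evalL := by
    ext1 w; exact (M.evalL_observe w).symm
  rw [this]
  exact ContinuousLinearMap.isPositive_self_comp_adjoint _

/-- The square root `C^{1/2}`. -/
noncomputable abbrev S (M : GaussianModel ν P) : Lp ℝ 2 ν →L[ℝ] Lp ℝ 2 ν := opSqrt M.C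

lemma S_S (M : GaussianModel ν P) (w : Lp ℝ 2 ν) : M.S (M.S w) = M.C w :=
  congrArg (fun A : Lp ℝ 2 ν →L[ℝ] Lp ℝ 2 ν => A w) (opSqrt_spec M.C_isPositive).2

lemma inner_S (M : GaussianModel ν P) (v w : Lp ℝ 2 ν) : ⟪M.S v, w⟫_ℝ = ⟪v, M.S w⟫_ℝ :=
  (opSqrt_spec M.C_isPositive).1.isSymmetric v w

lemma S_injective (M : GaussianModel ν P) : Function.Injective M.S := by
  refine (injective_iff_map_eq_zero _).2 fun w hw => ?_
  by_contra h0
  have h1 := M.covOp_posDef w h0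
  have h2 : M.C w = 0 := by rw [← M.S_S, hw, map_zero]
  rw [show covOp ν M.cov w = 0 from h2, inner_zero_left] at h1
  exact h1.false

lemma denseRange_S (M : GaussianModel ν P) : DenseRange M.S := by
  have h : (LinearMap.range (M.S : Lp ℝ 2 ν →ₗ[ℝ] Lp ℝ 2 ν))ᗮ = ⊥ := by
    rw [eq_bot_iff]
    intro w hw
    rw [Submodule.mem_orthogonal] at hw
    refine M.S_injective (?_ : M.S w = M.S 0)
    rw [map_zero, ← inner_self_eq_zero (𝕜 := ℝ), inner_S, real_inner_comm]
    exact hw _ ⟨M.S w, rfl⟩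
  have := Submodule.topologicalClosure_eq_top_iff.2 h
  exact Submodule.dense_iff_topologicalClosure_eq_top.2 this

lemma inner_observe_observe (M : GaussianModel ν P) (v w : Lp ℝ 2 ν) :
    ⟪M.observe v, M.observe w⟫_ℝ = ⟪M.S v, M.S w⟫_ℝ := by
  rw [inner_observe, evalL_observe, ← S_S, inner_S]

lemma norm_observe (M : GaussianModel ν P) (w : Lp ℝ 2 ν) : ‖M.observe w‖ = ‖M.S w‖ := by
  rw [← sq_eq_sq₀ (norm_nonneg _) (norm_nonneg _), ← real_inner_self_eq_norm_sq,
    ← real_inner_self_eq_norm_sq, inner_observe_observe]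

lemma mem_H0_of_forall (M : GaussianModel ν P) (W : Submodule ℝ (Lp ℝ 2 P))
    (hW : IsClosed (W : Set (Lp ℝ 2 P))) (h : ∀ x, M.Z0 x ∈ W) : M.H0 ≤ W :=
  Submodule.topologicalClosure_minimal _ (Submodule.span_le.2 (by rintro _ ⟨x, rfl⟩; exact h x)) hW

lemma Z0_mem_H0 (M : GaussianModel ν P) (x : X) : M.Z0 x ∈ M.H0 :=
  Submodule.le_topologicalClosure _ (Submodule.subset_span ⟨x, rfl⟩)

lemma isClosed_H0 (M : GaussianModel ν P) : IsClosed (M.H0 : Set (Lp ℝ 2 P)) :=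
  Submodule.isClosed_topologicalClosure _

/-- Elements of the Cameron--Martin spaces that agree almost everywhere agree everywhere, since `ν`
charges all open sets. -/
lemma evalL_eq_iff_forall [ν.IsOpenPosMeasure] {Ω' : Type*} [MeasurableSpace Ω'] {P' : Measure Ω'}
    [IsProbabilityMeasure P'] (M : GaussianModel ν P) (M' : GaussianModel ν P') {h : Lp ℝ 2 P}
    {h' : Lp ℝ 2 P'} : M.evalL h = M'.evalL h' ↔ ∀ x, ⟪M.Z0 x, h⟫_ℝ = ⟪M'.Z0 x, h'⟫_ℝ := by
  constructor
  · intro heq x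
    have := ContinuousMap.toLp_injective (p := 2) (𝕜 := ℝ) ν heq
    exact congrArg (fun f : C(X, ℝ) => f x) this
  · intro hx
    have : M.eval h = M'.eval h' := by ext x; exact hx x
    exact congrArg (ContinuousMap.toLp 2 ν ℝ) this

/-- The polar decomposition of `observe`: an isometry `U` of `L₂(X, ν)` onto `ℋ⁰` turns `evalL` into
`C^{1/2}`. In particular the Cameron--Martin space consists of the functions `x ↦ ⟪Z⁰(x), h⟫` with
`h ∈ ℋ⁰`, with the norm of `h`. -/
lemma exists_isometry [ν.IsOpenPosMeasure] (M : GaussianModel ν P) :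
    ∃ U : Lp ℝ 2 ν →ₗᵢ[ℝ] Lp ℝ 2 P, (∀ w, U (M.S w) = M.observe w) ∧
      (∀ y, M.evalL (U y) = M.S y) ∧ ∀ h, h ∈ M.H0 ↔ ∃ y, U y = h := by
  have hbd : ∀ w, ‖(M.observe : Lp ℝ 2 ν →ₗ[ℝ] Lp ℝ 2 P) w‖ ≤
      1 * ‖(M.S : Lp ℝ 2 ν →ₗ[ℝ] Lp ℝ 2 ν) w‖ := fun w => by
    rw [one_mul]; exact (M.norm_observe w).le
  let U0 : Lp ℝ 2 ν →L[ℝ] Lp ℝ 2 P := (M.observe : Lp ℝ 2 ν →ₗ[ℝ] Lp ℝ 2 P).extendOfNorm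
    (M.S : Lp ℝ 2 ν →ₗ[ℝ] Lp ℝ 2 ν)
  have hU0 : ∀ w, U0 (M.S w) = M.observe w := fun w =>
    LinearMap.extendOfNorm_eq (f := (M.observe : Lp ℝ 2 ν →ₗ[ℝ] Lp ℝ 2 P))
      (e := (M.S : Lp ℝ 2 ν →ₗ[ℝ] Lp ℝ 2 ν)) M.denseRange_S ⟨1, hbd⟩ w
  have hnorm : ∀ y, ‖U0 y‖ = ‖y‖ := fun y =>
    M.denseRange_S.induction_on (p := fun y => ‖U0 y‖ = ‖y‖) y
      (isClosed_eq (by fun_prop) (by fun_prop)) fun w => by rw [hU0, norm_observe]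
  let U : Lp ℝ 2 ν →ₗᵢ[ℝ] Lp ℝ 2 P := ⟨U0, hnorm⟩
  have hUS : ∀ w, U (M.S w) = M.observe w := hU0
  have heval : ∀ y, M.evalL (U y) = M.S y := fun y => by
    refine ext_inner_left ℝ fun w => ?_
    rw [← inner_observe, ← hUS, U.inner_map_map, inner_S]
  have hclosed : IsClosed (LinearMap.range U.toLinearMap : Set (Lp ℝ 2 P)) := by
    exact U.isometry.isClosedEmbedding.isClosed_range
  refine ⟨U, hUS, heval, fun h => ⟨fun hh => ?_, ?_⟩⟩
  · -- what is orthogonal to the range is orthogonal to the process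
    have : CompleteSpace (LinearMap.range U.toLinearMap) :=
      IsClosed.completeSpace_coe (hs := hclosed)
    refine M.mem_H0_of_forall (LinearMap.range U.toLinearMap) hclosed (fun x => ?_) hh
    rw [← Submodule.orthogonal_orthogonal (LinearMap.range U.toLinearMap),
      Submodule.mem_orthogonal']
    intro u hu
    have h0 : M.evalL u = M.evalL 0 := by
      rw [map_zero]
      refine ext_inner_left ℝ fun w => ?_
      rw [← inner_observe, inner_zero_right, ← hUS]
      exact (Submodule.mem_orthogonal _ _).1 hu _ ⟨_, rfl⟩
    rw [(M.evalL_eq_iff_forall M).1 h0 x, inner_zero_right]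
  · rintro ⟨y, rfl⟩
    refine M.denseRange_S.induction_on (p := fun y => U y ∈ M.H0) y
      (M.isClosed_H0.preimage U.continuous) fun w => ?_
    have : CompleteSpace M.H0 := IsClosed.completeSpace_coe (hs := M.isClosed_H0)
    rw [hUS, ← Submodule.orthogonal_orthogonal M.H0, Submodule.mem_orthogonal']
    intro u hu
    have h0 : M.evalL u = M.evalL 0 := by
      rw [M.evalL_eq_iff_forall M]
      intro x
      rw [inner_zero_right]
      exact (Submodule.mem_orthogonal _ _).1 hu _ (M.Z0_mem_H0 x)
    rw [inner_observe, h0, map_zero, inner_zero_right]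

lemma linearIndependent_Z0 (M : GaussianModel ν P) : LinearIndependent ℝ M.Z0 := by
  classical
  rw [linearIndependent_iff']
  intro s g hg x hx
  by_contra hne
  have h1 := M.cov_posDef s g ⟨x, hx, hne⟩
  have h2 : ⟪∑ x ∈ s, g x • M.Z0 x, ∑ y ∈ s, g y • M.Z0 y⟫_ℝ =
      ∑ x ∈ s, ∑ y ∈ s, g x * g y * M.cov (x, y) := by
    rw [sum_inner]
    refine Finset.sum_congr rfl fun x _ => ?_
    rw [inner_sum]
    refine Finset.sum_congr rfl fun y _ => ?_
    rw [inner_smul_left, inner_smul_right, inner_Z0]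
    simp; ring
  rw [← h2, hg, inner_zero_left] at h1
  exact h1.false

end OneModel

end GaussianModel

/-! ### Joint observables of two Gaussian models -/

section Bridge

open GaussianModel

variable {X : Type*} [MetricSpace X] [CompactSpace X] [MeasurableSpace X] [BorelSpace X]
  {ν : Measure X} [IsFiniteMeasure ν]
  {Ω : Type*} [MeasurableSpace Ω] {P : Measure Ω} [IsProbabilityMeasure P]
  {Ω' : Type*} [MeasurableSpace Ω'] {P' : Measure Ω'} [IsProbabilityMeasure P']

/-- The version under the first model of a joint observable. -/
noncomputable def jointFst (M : GaussianModel ν P) (M' : GaussianModel ν P') :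
    jointSpace M M' →L[ℝ] Lp ℝ 2 P :=
  (ContinuousLinearMap.fst ℝ _ _).comp (jointSpace M M').subtypeL

/-- The version under the second model of a joint observable. -/
noncomputable def jointSnd (M : GaussianModel ν P) (M' : GaussianModel ν P') :
    jointSpace M M' →L[ℝ] Lp ℝ 2 P' :=
  (ContinuousLinearMap.snd ℝ _ _).comp (jointSpace M M').subtypeL

variable (M : GaussianModel ν P) (M' : GaussianModel ν P')

instance completeSpace_jointSpace : CompleteSpace (jointSpace M M') :=
  IsClosed.completeSpace_coe (hs := Submodule.isClosed_topologicalClosure _)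

lemma norm_le_jointFst_add_jointSnd (g : jointSpace M M') :
    ‖g‖ ≤ ‖jointFst M M' g‖ + ‖jointSnd M M' g‖ :=
  max_le (le_add_of_nonneg_right (norm_nonneg _)) (le_add_of_nonneg_left (norm_nonneg _))

lemma norm_le_jointSnd_add_jointFst (g : jointSpace M M') :
    ‖g‖ ≤ ‖jointSnd M M' g‖ + ‖jointFst M M' g‖ := by
  rw [add_comm]; exact norm_le_jointFst_add_jointSnd M M' g

/-- The value at `x` of the two centered processes. -/
noncomputable def jointZ0 (x : X) : jointSpace M M' :=
  ⟨(M.Z0 x, M'.Z0 x), Submodule.le_topologicalClosure _ (Submodule.subset_span ⟨x, rfl⟩)⟩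

/-- The joint observables `jointZ0 x` span a dense subspace. -/
lemma eq_top_of_jointZ0_mem (W : Submodule ℝ (jointSpace M M'))
    (hW : IsClosed (W : Set (jointSpace M M'))) (h : ∀ x, jointZ0 M M' x ∈ W) : W = ⊤ := by
  have hcl : IsClosed ((W.map (jointSpace M M').subtype : Submodule ℝ (Lp ℝ 2 P × Lp ℝ 2 P')) :
      Set (Lp ℝ 2 P × Lp ℝ 2 P')) :=
    ((Submodule.isClosed_topologicalClosure _).isClosedEmbedding_subtypeVal.isClosedMap) _ hW
  have hle : jointSpace M M' ≤ W.map (jointSpace M M').subtype :=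
    Submodule.topologicalClosure_minimal _ (Submodule.span_le.2 (by
      rintro _ ⟨x, rfl⟩; exact ⟨_, h x, rfl⟩)) hcl
  rw [eq_top_iff]
  rintro g -
  obtain ⟨g', hg', heq⟩ := hle g.2
  rwa [← Subtype.ext heq]

lemma jointFst_mem_H0 (g : jointSpace M M') : jointFst M M' g ∈ M.H0 := by
  have := eq_top_of_jointZ0_mem M M' (M.H0.comap (jointFst M M' : jointSpace M M' →ₗ[ℝ] Lp ℝ 2 P))
    (M.isClosed_H0.preimage (jointFst M M').continuous) M.Z0_mem_H0
  exact Submodule.mem_comap.1 (this ▸ Submodule.mem_top : g ∈ _)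

lemma jointSnd_mem_H0 (g : jointSpace M M') : jointSnd M M' g ∈ M'.H0 := by
  have := eq_top_of_jointZ0_mem M M' (M'.H0.comap (jointSnd M M' : jointSpace M M' →ₗ[ℝ] Lp ℝ 2 P'))
    (M'.isClosed_H0.preimage (jointSnd M M').continuous) M'.Z0_mem_H0
  exact Submodule.mem_comap.1 (this ▸ Submodule.mem_top : g ∈ _)

variable {M M'}

lemma exists_jointFst_eq (he : FormEquiv (jointFst M M') (jointSnd M M')) {h : Lp ℝ 2 P}
    (hh : h ∈ M.H0) : ∃ g, jointFst M M' g = h :=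
  M.mem_H0_of_forall (LinearMap.range (jointFst M M' : jointSpace M M' →ₗ[ℝ] Lp ℝ 2 P))
    (he.symm.isClosed_range (norm_le_jointSnd_add_jointFst M M'))
    (fun x => ⟨jointZ0 M M' x, rfl⟩) hh

lemma exists_jointSnd_eq (he : FormEquiv (jointFst M M') (jointSnd M M')) {h : Lp ℝ 2 P'}
    (hh : h ∈ M'.H0) : ∃ g, jointSnd M M' g = h :=
  M'.mem_H0_of_forall (LinearMap.range (jointSnd M M' : jointSpace M M' →ₗ[ℝ] Lp ℝ 2 P'))
    (he.isClosed_range (norm_le_jointFst_add_jointSnd M M')) (fun x => ⟨jointZ0 M M' x, rfl⟩) hh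

lemma forall_inner_eq_of_forall_Z0 {h : Lp ℝ 2 P} {h' : Lp ℝ 2 P'}
    (hx : ∀ x, ⟪M.Z0 x, h⟫_ℝ = ⟪M'.Z0 x, h'⟫_ℝ) (g : jointSpace M M') :
    ⟪jointFst M M' g, h⟫_ℝ = ⟪jointSnd M M' g, h'⟫_ℝ := by
  let φ : jointSpace M M' →L[ℝ] ℝ :=
    (innerSL ℝ h).comp (jointFst M M') - (innerSL ℝ h').comp (jointSnd M M')
  have := eq_top_of_jointZ0_mem M M' (LinearMap.ker (φ : jointSpace M M' →ₗ[ℝ] ℝ))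
    φ.isClosed_ker fun x => by
      have := hx x
      rw [real_inner_comm, real_inner_comm h'] at this
      exact sub_eq_zero.2 this
  have hg : φ g = 0 := LinearMap.mem_ker.1 (this ▸ Submodule.mem_top : g ∈ _)
  rw [real_inner_comm, real_inner_comm h']
  exact sub_eq_zero.1 hg

/-- Two elements of the Cameron--Martin spaces agree if and only if their representatives induce
the same functional on joint observables. -/
lemma evalL_eq_iff [ν.IsOpenPosMeasure] {h : Lp ℝ 2 P} {h' : Lp ℝ 2 P'} :
    M.evalL h = M'.evalL h' ↔
      ∀ g, ⟪jointFst M M' g, h⟫_ℝ = ⟪jointSnd M M' g, h'⟫_ℝ := by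
  rw [M.evalL_eq_iff_forall M']
  exact ⟨forall_inner_eq_of_forall_Z0, fun hg x => hg (jointZ0 M M' x)⟩

/-- The Cameron--Martin spaces are norm equivalent if and only if the two variances of joint
observables are equivalent. -/
lemma assumptionI_iff [ν.IsOpenPosMeasure] :
    AssumptionI M M' ↔ FormEquiv (jointFst M M') (jointSnd M M') := by
  obtain ⟨U, -, hUS, hUr⟩ := M.exists_isometry
  obtain ⟨U', -, hUS', hUr'⟩ := M'.exists_isometry
  have hiff : ∀ v v', M.S v = M'.S v' ↔
      ∀ g, ⟪jointFst M M' g, U v⟫_ℝ = ⟪jointSnd M M' g, U' v'⟫_ℝ := fun v v' => by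
    rw [← hUS, ← hUS']; exact evalL_eq_iff
  have hcancel : ∀ {x c y z : ℝ}, 0 ≤ x → x * x ≤ y → y ≤ c * z * x → 0 ≤ c * z → x ≤ c * z := by
    intro x c y z hx h1 h2 h3
    rcases hx.eq_or_lt with h0 | h0
    · rwa [← h0]
    · exact le_of_mul_le_mul_right (h1.trans h2) h0
  constructor
  · rintro ⟨hrange, k, K, hk, hK, hkK⟩
    refine ⟨K⁻¹, k⁻¹, by positivity, by positivity, fun g => ⟨?_, ?_⟩⟩
    · rw [inv_mul_le_iff₀ hK]
      obtain ⟨v, hv⟩ := (hUr _).1 (jointFst_mem_H0 M M' g)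
      obtain ⟨v', hv'⟩ : M.S v ∈ Set.range (opSqrt M'.C) := hrange ▸ ⟨v, rfl⟩
      have h1 := (hiff v v').1 hv'.symm g
      rw [hv, real_inner_self_eq_norm_mul_norm] at h1
      have h2 := real_inner_le_norm (jointSnd M M' g) (U' v')
      have h3 := (hkK v v' hv'.symm).2
      rw [U'.norm_map] at h2
      rw [← U.norm_map v, hv] at h3
      refine hcancel (norm_nonneg _) (h1.le.trans h2) ?_ (by positivity)
      have := mul_le_mul_of_nonneg_left h3 (norm_nonneg (jointSnd M M' g))
      linarith
    · obtain ⟨v', hv'⟩ := (hUr' _).1 (jointSnd_mem_H0 M M' g)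
      obtain ⟨v, hv⟩ : M'.S v' ∈ Set.range (opSqrt M.C) := hrange ▸ ⟨v', rfl⟩
      have h1 := (hiff v v').1 hv g
      rw [hv', real_inner_self_eq_norm_mul_norm] at h1
      have h2 := real_inner_le_norm (jointFst M M' g) (U v)
      have h3 := (le_inv_mul_iff₀ hk).2 (hkK v v' hv).1
      rw [U.norm_map] at h2
      rw [← U'.norm_map v', hv'] at h3
      refine hcancel (norm_nonneg _) (h1.ge.trans h2) ?_ (by positivity)
      have := mul_le_mul_of_nonneg_left h3 (norm_nonneg (jointFst M M' g))
      linarith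
  · intro he
    obtain ⟨k, K, hk, hK, hkK⟩ := id he
    refine ⟨Set.Subset.antisymm ?_ ?_, K⁻¹, k⁻¹, by positivity, by positivity,
      fun v v' hvv => ⟨?_, ?_⟩⟩
    · rintro _ ⟨v, rfl⟩
      obtain ⟨z, hz⟩ := he.exists_inner_eq (norm_le_jointFst_add_jointSnd M M') (U v)
      obtain ⟨v', hv'⟩ := (hUr' _).1 (jointSnd_mem_H0 M M' z)
      refine ⟨v', ((hiff v v').2 fun g => ?_).symm⟩
      rw [hv', hz]
    · rintro _ ⟨v', rfl⟩
      obtain ⟨z, hz⟩ := he.symm.exists_inner_eq (norm_le_jointSnd_add_jointFst M M') (U' v')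
      obtain ⟨v, hv⟩ := (hUr _).1 (jointFst_mem_H0 M M' z)
      refine ⟨v, (hiff v v').2 fun g => ?_⟩
      rw [hv, hz]
    · rw [inv_mul_le_iff₀ hK]
      obtain ⟨g, hg⟩ := exists_jointFst_eq he ((hUr (U v)).2 ⟨v, rfl⟩)
      have h1 := (hiff v v').1 hvv g
      rw [hg, real_inner_self_eq_norm_mul_norm, U.norm_map] at h1
      have h2 := real_inner_le_norm (jointSnd M M' g) (U' v')
      have h3 := (hkK g).2
      rw [hg, U.norm_map] at h3
      rw [U'.norm_map] at h2
      refine hcancel (norm_nonneg _) (h1.le.trans h2) ?_ (by positivity)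
      have := mul_le_mul_of_nonneg_right h3 (norm_nonneg v')
      linarith
    · obtain ⟨g, hg⟩ := exists_jointSnd_eq he ((hUr' (U' v')).2 ⟨v', rfl⟩)
      have h1 := (hiff v v').1 hvv g
      rw [hg, real_inner_self_eq_norm_mul_norm, U'.norm_map] at h1
      have h2 := real_inner_le_norm (jointFst M M' g) (U v)
      have h3 := (le_inv_mul_iff₀ hk).2 (hkK g).1
      rw [hg, U'.norm_map] at h3
      rw [U.norm_map] at h2
      refine hcancel (norm_nonneg _) (h1.ge.trans h2) ?_ (by positivity)
      have := mul_le_mul_of_nonneg_right h3 (norm_nonneg v)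
      linarith

/-- The smoothed observables `∫ w(x) Z⁰(x) dν(x)` under the two models are versions of each
other. -/
lemma jointSnd_eq_observe [ν.IsOpenPosMeasure] (he : FormEquiv (jointFst M M') (jointSnd M M'))
    {w : Lp ℝ 2 ν} {g : jointSpace M M'} (hg : jointFst M M' g = M.observe w) :
    jointSnd M M' g = M'.observe w := by
  obtain ⟨U', hUo', -, hUr'⟩ := M'.exists_isometry
  obtain ⟨y, hy⟩ := exists_jointSnd_eq he ((hUr' (M'.observe w)).2 ⟨_, hUo' w⟩)
  have key : ∀ z, ⟪jointSnd M M' g, jointSnd M M' z⟫_ℝ = ⟪M'.observe w, jointSnd M M' z⟫_ℝ := by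
    intro z
    obtain ⟨u, hu⟩ := he.symm.exists_inner_eq (norm_le_jointSnd_add_jointFst M M')
      (jointSnd M M' z)
    rw [← hu, hg, inner_observe, inner_observe, evalL_eq_iff.2 hu]
  have h0 := key (g - y)
  rw [← sub_eq_zero, ← inner_sub_left, ← hy, ← map_sub, inner_self_eq_zero, map_sub, hy,
    sub_eq_zero] at h0
  exact h0

/-- The unitary `U` of `GaussianModel.exists_isometry`, with values in the joint observables. -/
lemma exists_isometry_joint [ν.IsOpenPosMeasure]
    (he : FormEquiv (jointFst M M') (jointSnd M M')) :
    ∃ e : Lp ℝ 2 ν →L[ℝ] jointSpace M M',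
      (∀ y z, ⟪jointFst M M' (e y), jointFst M M' (e z)⟫_ℝ = ⟪y, z⟫_ℝ) ∧
      (∀ w, jointSnd M M' (e (M.S w)) = M'.observe w) ∧ Function.Surjective e := by
  obtain ⟨U, hUo, hUS, hUr⟩ := M.exists_isometry
  obtain ⟨c, hc⟩ := he.symm.exists_antilipschitzWith (norm_le_jointSnd_add_jointFst M M')
  have hcl := he.symm.isClosed_range (norm_le_jointSnd_add_jointFst M M')
  have hmem : ∀ y, ∃ g, jointFst M M' g = U y := fun y =>
    exists_jointFst_eq he ((hUr _).2 ⟨y, rfl⟩)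
  let e : Lp ℝ 2 ν →L[ℝ] jointSpace M M' :=
    ((jointFst M M').equivRange hc.injective hcl).symm.toContinuousLinearMap.comp
      (U.toContinuousLinearMap.codRestrict
        (LinearMap.range (jointFst M M' : jointSpace M M' →ₗ[ℝ] Lp ℝ 2 P)) hmem)
  have he1 : ∀ y, jointFst M M' (e y) = U y := fun y =>
    congrArg Subtype.val (((jointFst M M').equivRange hc.injective hcl).apply_symm_apply
      ⟨U y, hmem y⟩)
  refine ⟨e, fun y z => ?_, fun w => ?_, fun g => ?_⟩
  · rw [he1, he1, U.inner_map_map]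
  · exact jointSnd_eq_observe he ((he1 _).trans (hUo w))
  · obtain ⟨y, hy⟩ := (hUr _).1 (jointFst_mem_H0 M M' g)
    exact ⟨y, hc.injective ((he1 y).trans hy)⟩

/-- Under the unitary equivalence of `ℋ⁰` and `L₂(X, ν)` the operator `C^{-1/2} C' C^{-1/2}` is the
operator of the quadratic form `g ↦ ‖jointSnd g‖²`. -/
lemma assumptionIII_iff [ν.IsOpenPosMeasure] (he : FormEquiv (jointFst M M') (jointSnd M M'))
    (a : ℝ) : AssumptionIII M M' a ↔ 0 < a ∧ FormApprox (jointFst M M') (jointSnd M M') a := by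
  refine and_congr_right fun _ => ?_
  obtain ⟨e, hinner, he2, hsurj⟩ := exists_isometry_joint he
  have hnorm : ∀ y, ‖jointFst M M' (e y)‖ ^ 2 = ‖y‖ ^ 2 := fun y => by
    rw [← real_inner_self_eq_norm_sq, hinner, real_inner_self_eq_norm_sq]
  obtain ⟨R, hR⟩ : ∃ R : Lp ℝ 2 ν →L[ℝ] Lp ℝ 2 P', ∀ y, R y = jointSnd M M' (e y) :=
    ⟨(jointSnd M M').comp e, fun y => rfl⟩
  have hCform : ∀ v w, ⟪R (M.S v), R (M.S w)⟫_ℝ = ⟪M'.C v, w⟫_ℝ := fun v w => by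
    rw [hR, hR, he2, he2, inner_observe_observe, ← M'.S_S, M'.inner_S (M'.S v)]
  constructor
  · rintro ⟨T, hT, hcomp⟩
    have hTR : ∀ y, ⟪T y, y⟫_ℝ = ‖R y‖ ^ 2 := fun y =>
      M.denseRange_S.induction_on (p := fun y => ⟪T y, y⟫_ℝ = ‖R y‖ ^ 2) y
        (isClosed_eq (by fun_prop) (by fun_prop)) fun w => by
          rw [← real_inner_self_eq_norm_sq, hCform, ← hT, M.inner_S]
    intro ε hε
    obtain ⟨F, hF, hFε⟩ := exists_abs_inner_le_of_isCompactOperator hcomp hε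
    refine ⟨F.map (e : Lp ℝ 2 ν →ₗ[ℝ] jointSpace M M'), inferInstance, fun g hg => ?_⟩
    obtain ⟨y, rfl⟩ := hsurj g
    have h1 := hFε y ((Submodule.mem_orthogonal' _ _).2 fun f hf => by
      rw [← hinner]; exact hg _ ⟨f, hf, rfl⟩)
    have h2 : ⟪(T - a • ContinuousLinearMap.id ℝ (Lp ℝ 2 ν)) y, y⟫_ℝ =
        ‖R y‖ ^ 2 - a * ‖y‖ ^ 2 := by
      rw [← hTR]
      simp [inner_sub_left, inner_smul_left]
    rw [h2, hR] at h1
    rw [hnorm]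
    exact h1
  · intro happ
    obtain ⟨T, hT⟩ : ∃ T : Lp ℝ 2 ν →L[ℝ] Lp ℝ 2 ν, ∀ y z, ⟪T y, z⟫_ℝ = ⟪R y, R z⟫_ℝ :=
      ⟨ContinuousLinearMap.adjoint R ∘L R,
        fun y z => ContinuousLinearMap.adjoint_inner_left R z (R y)⟩
    have hT' : ∀ y z, ⟪y, T z⟫_ℝ = ⟪R y, R z⟫_ℝ := fun y z => by
      rw [real_inner_comm, hT, real_inner_comm]
    refine ⟨T, fun v => ext_inner_right ℝ fun w => ?_,
      isCompactOperator_of_abs_inner_le (fun x y => ?_) fun ε hε => ?_⟩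
    · rw [M.inner_S, hT, hCform]
    · simp [inner_sub_left, inner_sub_right, inner_smul_left, inner_smul_right, hT, hT']
    · obtain ⟨V, hV, hVε⟩ := happ ε hε
      let A : jointSpace M M' →L[ℝ] Lp ℝ 2 ν :=
        (ContinuousLinearMap.adjoint ((jointFst M M').comp e)).comp (jointFst M M')
      have hA : ∀ y v, ⟪y, A v⟫_ℝ = ⟪jointFst M M' (e y), jointFst M M' v⟫_ℝ := fun y v =>
        ContinuousLinearMap.adjoint_inner_right ((jointFst M M').comp e) y (jointFst M M' v)
      refine ⟨V.map (A : jointSpace M M' →ₗ[ℝ] Lp ℝ 2 ν), inferInstance, fun y hy => ?_⟩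
      have h1 := hVε (e y) fun v hv => by
        rw [← hA]; exact (Submodule.mem_orthogonal' _ _).1 hy _ ⟨v, hv, rfl⟩
      have h2 : ⟪(T - a • ContinuousLinearMap.id ℝ (Lp ℝ 2 ν)) y, y⟫_ℝ =
          ‖R y‖ ^ 2 - a * ‖y‖ ^ 2 := by
        simp [inner_sub_left, inner_smul_left, hT]
      rw [h2, hR]
      rw [hnorm] at h1
      exact h1

end Bridge

/-! ### Best linear predictors -/

namespace GaussianModel

section Center

variable {Ω : Type*} [MeasurableSpace Ω] {P : Measure Ω}

lemma integral_mul_eq_inner (f g : Lp ℝ 2 P) : ∫ ω, f ω * g ω ∂P = ⟪f, g⟫_ℝ := by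
  rw [L2.inner_def]
  refine integral_congr_ae (Eventually.of_forall fun ω => ?_)
  simp [mul_comm]

lemma integral_sq_eq_norm_sq (f : Lp ℝ 2 P) : ∫ ω, (f ω) ^ 2 ∂P = ‖f‖ ^ 2 := by
  rw [← real_inner_self_eq_norm_sq, ← integral_mul_eq_inner]
  simp only [sq]

lemma isPredictor_iff {W : Submodule ℝ (Lp ℝ 2 P)} {h g : Lp ℝ 2 P} :
    IsPredictor W h g ↔ g ∈ W ∧ ∀ f ∈ W, ⟪g - h, f⟫_ℝ = 0 := by
  simp only [IsPredictor, integral_mul_eq_inner]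

lemma IsPredictor.predictor_eq {W : Submodule ℝ (Lp ℝ 2 P)} {h g : Lp ℝ 2 P}
    (hg : IsPredictor W h g) : predictor W h = g := by
  have h1 : IsPredictor W h (predictor W h) := Classical.epsilon_spec ⟨g, hg⟩
  rw [isPredictor_iff] at hg h1
  have hmem := Submodule.sub_mem W h1.1 hg.1
  have h2 : ⟪predictor W h - g, predictor W h - g⟫_ℝ = 0 := by
    have h3 := h1.2 _ hmem
    have h4 := hg.2 _ hmem
    rw [← sub_sub_sub_cancel_right (predictor W h) g h, inner_sub_left,
      sub_sub_sub_cancel_right, h3, h4, sub_zero]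
  exact sub_eq_zero.1 (inner_self_eq_zero.1 h2)

variable [IsProbabilityMeasure P]

/-- The constant observable `1`. -/
noncomputable def constOne (P : Measure Ω) [IsProbabilityMeasure P] : Lp ℝ 2 P := Lp.const 2 P 1

lemma const_eq_smul (c : ℝ) : Lp.const 2 P c = c • constOne P := by
  have := (Lp.constₗ (E := ℝ) 2 P ℝ).map_smul c 1
  simpa [constOne] using this

lemma integral_eq_inner (f : Lp ℝ 2 P) : ∫ ω, f ω ∂P = ⟪constOne P, f⟫_ℝ := by
  rw [← integral_mul_eq_inner]
  refine integral_congr_ae ?_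
  filter_upwards [Lp.coeFn_const (p := 2) (μ := P) (1 : ℝ)] with ω hω
  rw [constOne, hω]
  simp

lemma norm_constOne : ‖constOne P‖ = 1 := by
  have : NeZero P := ⟨IsProbabilityMeasure.ne_zero P⟩
  simp [constOne, Lp.norm_const]

lemma center_eq (h : Lp ℝ 2 P) : center h = h - ⟪constOne P, h⟫_ℝ • constOne P := by
  rw [center, const_eq_smul, integral_eq_inner]

lemma eq_add_center (h : Lp ℝ 2 P) : h = ⟪constOne P, h⟫_ℝ • constOne P + center h := by
  rw [center_eq]; abel

lemma center_add (f g : Lp ℝ 2 P) : center (f + g) = center f + center g := by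
  simp only [center_eq, inner_add_right, add_smul]; abel

lemma center_sub (f g : Lp ℝ 2 P) : center (f - g) = center f - center g := by
  simp only [center_eq, inner_sub_right, sub_smul]; abel

lemma inner_constOne_center (h : Lp ℝ 2 P) : ⟪constOne P, center h⟫_ℝ = 0 := by
  rw [center_eq, inner_sub_right, inner_smul_right, real_inner_self_eq_norm_sq, norm_constOne]
  ring

lemma center_of_inner_eq_zero {h : Lp ℝ 2 P} (hh : ⟪constOne P, h⟫_ℝ = 0) : center h = h := by
  rw [center_eq, hh, zero_smul, sub_zero]

lemma center_smul_constOne (c : ℝ) : center (c • constOne P) = 0 := by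
  rw [center_eq, inner_smul_right, real_inner_self_eq_norm_sq, norm_constOne]; simp

lemma variance_eq_norm_center_sq (f : Lp ℝ 2 P) : Var[f; P] = ‖center f‖ ^ 2 := by
  rw [variance_eq_integral (Lp.memLp f).aestronglyMeasurable.aemeasurable,
    ← integral_sq_eq_norm_sq]
  refine integral_congr_ae ?_
  filter_upwards [Lp.coeFn_sub f (Lp.const 2 P (∫ ω, f ω ∂P)),
    Lp.coeFn_const (p := 2) (μ := P) (∫ ω, f ω ∂P)] with ω h1 h2
  rw [center, h1, Pi.sub_apply, h2]
  rfl

lemma norm_sq_eq (f : Lp ℝ 2 P) : ‖f‖ ^ 2 = ⟪constOne P, f⟫_ℝ ^ 2 + ‖center f‖ ^ 2 := by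
  have h1 := norm_add_sq_real (⟪constOne P, f⟫_ℝ • constOne P) (center f)
  rw [← eq_add_center, inner_smul_left, inner_constOne_center, norm_smul, norm_constOne] at h1
  rw [h1]; simp

lemma mem_constants_sup {V : Submodule ℝ (Lp ℝ 2 P)} (hV : ∀ v ∈ V, ⟪constOne P, v⟫_ℝ = 0)
    {h : Lp ℝ 2 P} : h ∈ constants P ⊔ V ↔ center h ∈ V := by
  constructor
  · intro hh
    obtain ⟨c, hc, v, hv, rfl⟩ := Submodule.mem_sup.1 hh
    obtain ⟨t, rfl⟩ := Submodule.mem_span_singleton.1 hc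
    have h1 : center (t • Lp.const 2 P (1 : ℝ)) = 0 := center_smul_constOne t
    rwa [center_add, h1, zero_add, center_of_inner_eq_zero (hV v hv)]
  · intro hh
    rw [eq_add_center h]
    exact Submodule.add_mem_sup (Submodule.mem_span_singleton.2 ⟨_, rfl⟩) hh

variable {X : Type*} [MetricSpace X] [CompactSpace X] [MeasurableSpace X] [BorelSpace X]
  {ν : Measure X} [IsFiniteMeasure ν]

lemma inner_constOne_of_mem_H0 (M : GaussianModel ν P) {h : Lp ℝ 2 P} (hh : h ∈ M.H0) :
    ⟪constOne P, h⟫_ℝ = 0 := by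
  have hle := M.mem_H0_of_forall (LinearMap.ker (innerSL ℝ (constOne P) : Lp ℝ 2 P →ₗ[ℝ] ℝ))
    (innerSL ℝ (constOne P)).isClosed_ker fun x => by
      have h1 : ⟪constOne P, M.Z0 x⟫_ℝ = 0 := by
        rw [← integral_eq_inner, ← sub_self (M.mean x)]
        rw [Z0, integral_congr_ae (M.memLp_centered x).coeFn_toLp, integral_sub
          ((M.isGaussian.hasGaussianLaw_eval x).memLp_two.integrable (by norm_num))
          (integrable_const _), M.integral_eq]
        simp
      exact h1
  exact hle hh

lemma center_of_mem_H0 (M : GaussianModel ν P) {h : Lp ℝ 2 P} (hh : h ∈ M.H0) : center h = h :=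
  center_of_inner_eq_zero (M.inner_constOne_of_mem_H0 hh)

lemma mem_H_iff (M : GaussianModel ν P) {h : Lp ℝ 2 P} : h ∈ M.H ↔ center h ∈ M.H0 :=
  mem_constants_sup fun _ hv => M.inner_constOne_of_mem_H0 hv

end Center

end GaussianModel

section Predictors

open GaussianModel

variable {X : Type*} [MetricSpace X] [CompactSpace X] [MeasurableSpace X] [BorelSpace X]
  {ν : Measure X} [IsFiniteMeasure ν]
  {Ω : Type*} [MeasurableSpace Ω] {P : Measure Ω} [IsProbabilityMeasure P]
  {Ω' : Type*} [MeasurableSpace Ω'] {P' : Measure Ω'} [IsProbabilityMeasure P']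
  {M : GaussianModel ν P} {M' : GaussianModel ν P'}

variable (M M') in
/-- The space `ℝ ⊕ V`, as a space of observables of the first model. -/
noncomputable def spaceOf (V : Submodule ℝ (jointSpace M M')) : Submodule ℝ (Lp ℝ 2 P) :=
  constants P ⊔ V.map (jointFst M M' : jointSpace M M' →ₗ[ℝ] Lp ℝ 2 P)

lemma inner_constOne_jointFst (g : jointSpace M M') : ⟪constOne P, jointFst M M' g⟫_ℝ = 0 :=
  M.inner_constOne_of_mem_H0 (jointFst_mem_H0 M M' g)

lemma center_jointFst (g : jointSpace M M') : center (jointFst M M' g) = jointFst M M' g :=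
  center_of_inner_eq_zero (inner_constOne_jointFst g)

lemma mem_spaceOf {V : Submodule ℝ (jointSpace M M')} {h : Lp ℝ 2 P} :
    h ∈ spaceOf M M' V ↔ ∃ v ∈ V, jointFst M M' v = center h := by
  rw [spaceOf, mem_constants_sup]
  · rfl
  · rintro _ ⟨v, -, rfl⟩; exact inner_constOne_jointFst v

lemma isCommon_iff {h : Lp ℝ 2 P} : IsCommon M M' h ↔ ∃ g, jointFst M M' g = center h :=
  ⟨fun ⟨h', hh⟩ => ⟨⟨_, hh⟩, rfl⟩, fun ⟨g, hg⟩ => ⟨jointSnd M M' g, by rw [← hg]; exact g.2⟩⟩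

lemma Compatible.injective_jointFst (hc : Compatible M M') :
    Function.Injective (jointFst M M') := by
  refine (injective_iff_map_eq_zero _).2 fun g hg => ?_
  exact Subtype.ext (Prod.ext hg ((hc _ _ g.2).1 hg))

lemma Compatible.injective_jointSnd (hc : Compatible M M') :
    Function.Injective (jointSnd M M') := by
  refine (injective_iff_map_eq_zero _).2 fun g hg => ?_
  exact Subtype.ext (Prod.ext ((hc _ _ g.2).2 hg) hg)

lemma Compatible.var'_eq (hc : Compatible M M') {h : Lp ℝ 2 P} {g : jointSpace M M'}
    (hg : jointFst M M' g = center h) : var' M M' h = ‖jointSnd M M' g‖ ^ 2 := by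
  have h1 : (center h, counterpart M M' h) ∈ jointSpace M M' :=
    Classical.epsilon_spec (p := fun h' => (center h, h') ∈ jointSpace M M')
      (isCommon_iff.2 ⟨g, hg⟩)
  have h2 : (⟨_, h1⟩ : jointSpace M M') = g := hc.injective_jointFst hg.symm
  have h3 : counterpart M M' h = jointSnd M M' g := by rw [← h2]; rfl
  rw [var', h3, variance_eq_norm_center_sq, M'.center_of_mem_H0 (jointSnd_mem_H0 M M' g)]

/-- The error of the best linear predictor under the first model is, up to sign, the part of the
observable that is perpendicular to `V`. -/
lemma predictor_spaceOf_sub {V : Submodule ℝ (jointSpace M M')} {h : Lp ℝ 2 P}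
    {g v : jointSpace M M'} (hg : jointFst M M' g = center h) (hv : v ∈ V)
    (hperp : PerpTo (jointFst M M') V (g - v)) :
    predictor (spaceOf M M' V) h - h = -jointFst M M' (g - v) := by
  have hpred : IsPredictor (spaceOf M M' V) h (h - jointFst M M' (g - v)) := by
    refine isPredictor_iff.2 ⟨mem_spaceOf.2 ⟨v, hv, ?_⟩, fun f hf => ?_⟩
    · rw [center_sub, center_jointFst, ← hg, map_sub]; abel
    · obtain ⟨u, hu, huf⟩ := mem_spaceOf.1 hf
      have h0 : ⟪jointFst M M' (g - v), constOne P⟫_ℝ = 0 := by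
        rw [real_inner_comm, inner_constOne_jointFst]
      rw [sub_sub_cancel_left, inner_neg_left, eq_add_center f, inner_add_right,
        inner_smul_right, h0, ← huf, hperp u hu]
      simp
  rw [hpred.predictor_eq]; abel

/-- The analogue of `predictor_spaceOf_sub` for the second model. The choice of the predictor, which
is unique up to constants only, does not matter after centering. -/
lemma Compatible.center_predictor'_spaceOf_sub (hc : Compatible M M')
    {V : Submodule ℝ (jointSpace M M')} {h : Lp ℝ 2 P}
    {g v : jointSpace M M'} (hg : jointFst M M' g = center h) (hv : v ∈ V)
    (hperp : PerpTo (jointSnd M M') V (g - v)) :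
    jointFst M M' (v - g) = center (predictor' M M' (spaceOf M M' V) h - h) := by
  have hvar : ∀ u f, jointFst M M' u = center f → var' M M' (f - h) =
      ‖jointSnd M M' (u - g)‖ ^ 2 := fun u f huf =>
    hc.var'_eq (by rw [center_sub, ← huf, ← hg, map_sub])
  have hpy : ∀ u ∈ V, ‖jointSnd M M' (u - g)‖ ^ 2 =
      ‖jointSnd M M' (v - g)‖ ^ 2 + ‖jointSnd M M' (v - u)‖ ^ 2 := fun u hu => by
    have := hperp.norm_add_sq (Submodule.sub_mem _ hv hu)
    rw [sub_add_sub_cancel, ← neg_sub u g, ← neg_sub v g, map_neg, norm_neg, map_neg,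
      norm_neg] at this
    exact this
  have hex : IsPredictor' M M' (spaceOf M M' V) h (jointFst M M' v) := by
    refine ⟨mem_spaceOf.2 ⟨v, hv, (center_jointFst v).symm⟩, fun f hf => ?_⟩
    obtain ⟨u, hu, huf⟩ := mem_spaceOf.1 hf
    rw [hvar v _ (center_jointFst v).symm, hvar u f huf, hpy u hu]
    linarith [sq_nonneg ‖jointSnd M M' (v - u)‖]
  obtain ⟨hmem, hmin⟩ : IsPredictor' M M' (spaceOf M M' V) h (predictor' M M' (spaceOf M M' V) h) :=
    Classical.epsilon_spec ⟨_, hex⟩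
  obtain ⟨u, hu, huf⟩ := mem_spaceOf.1 hmem
  have h1 := hmin _ hex.1
  rw [hvar v _ (center_jointFst v).symm, hvar u _ huf, hpy u hu] at h1
  have h2 : ‖jointSnd M M' (v - u)‖ = 0 := by
    nlinarith [norm_nonneg (jointSnd M M' (v - u))]
  have h3 : v = u := sub_eq_zero.1 (hc.injective_jointSnd (by
    rw [norm_eq_zero.1 h2, map_zero]))
  rw [center_sub, ← huf, ← hg, h3, map_sub]

/-- A supremum over `ℋ₋ₙ` of a function of the four variances of the prediction errors, in terms of
the two prediction errors `g` and `g'`, which differ by an element of `V`. -/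
lemma Compatible.iSup_Hminus_le_iff (hc : Compatible M M') (V : Submodule ℝ (jointSpace M M'))
    [FiniteDimensional ℝ V] (Φ : ℝ → ℝ → ℝ → ℝ → ℝ) (x : ℝ≥0∞) :
    (⨆ h ∈ Hminus M M' (spaceOf M M' V), ENNReal.ofReal
      (Φ Var[predictor (spaceOf M M' V) h - h; P]
        Var[predictor' M M' (spaceOf M M' V) h - h; P]
        (var' M M' (predictor (spaceOf M M' V) h - h))
        (var' M M' (predictor' M M' (spaceOf M M' V) h - h)))) ≤ x ↔
    ∀ g g', g ≠ 0 → PerpTo (jointFst M M') V g → PerpTo (jointSnd M M') V g' → g - g' ∈ V →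
      ENNReal.ofReal (Φ (‖jointFst M M' g‖ ^ 2) (‖jointFst M M' g'‖ ^ 2)
        (‖jointSnd M M' g‖ ^ 2) (‖jointSnd M M' g'‖ ^ 2)) ≤ x := by
  have hval : ∀ h (g v v' : jointSpace M M'), jointFst M M' g = center h → v ∈ V → v' ∈ V →
      PerpTo (jointFst M M') V (g - v) → PerpTo (jointSnd M M') V (g - v') →
      Var[predictor (spaceOf M M' V) h - h; P] = ‖jointFst M M' (g - v)‖ ^ 2 ∧
      Var[predictor' M M' (spaceOf M M' V) h - h; P] = ‖jointFst M M' (g - v')‖ ^ 2 ∧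
      var' M M' (predictor (spaceOf M M' V) h - h) = ‖jointSnd M M' (g - v)‖ ^ 2 ∧
      var' M M' (predictor' M M' (spaceOf M M' V) h - h) = ‖jointSnd M M' (g - v')‖ ^ 2 := by
    intro h g v v' hg hv hv' hp hp'
    have h1 := predictor_spaceOf_sub hg hv hp
    have h2 := hc.center_predictor'_spaceOf_sub hg hv' hp'
    rw [← map_neg, neg_sub] at h1
    refine ⟨?_, ?_, ?_, ?_⟩
    · rw [variance_eq_norm_center_sq, h1, center_jointFst, ← neg_sub,
        map_neg, norm_neg]
    · rw [variance_eq_norm_center_sq, ← h2, ← neg_sub,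
        map_neg, norm_neg]
    · rw [hc.var'_eq (g := v - g) (by rw [h1, center_jointFst]), ← neg_sub,
        map_neg, norm_neg]
    · rw [hc.var'_eq h2, ← neg_sub,
        map_neg, norm_neg]
  have hinner : ∀ h (g v : jointSpace M M'), jointFst M M' g = center h → v ∈ V →
      PerpTo (jointFst M M') V (g - v) →
      ∫ ω, ((predictor (spaceOf M M' V) h - h) ω) ^ 2 ∂P = ‖jointFst M M' (g - v)‖ ^ 2 := by
    intro h g v hg hv hp
    rw [integral_sq_eq_norm_sq, predictor_spaceOf_sub hg hv hp, norm_neg]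
  constructor
  · intro hle g g' hg0 hg hg' hgg
    refine le_trans ?_ (le_trans (le_iSup₂ (jointFst M M' g) ⟨?_, ?_, ?_⟩) hle)
    · obtain ⟨h1, h2, h3, h4⟩ := hval (jointFst M M' g) g 0 (g - g') (center_jointFst g).symm
        V.zero_mem hgg (by rwa [sub_zero]) (by rwa [sub_sub_cancel])
      rw [h1, h2, h3, h4, sub_zero, sub_sub_cancel]
    · rw [mem_H_iff, center_jointFst]; exact jointFst_mem_H0 M M' g
    · exact isCommon_iff.2 ⟨g, (center_jointFst g).symm⟩
    · rw [hinner _ g 0 (center_jointFst g).symm V.zero_mem (by rwa [sub_zero]), sub_zero]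
      exact pow_pos (norm_pos_iff.2 fun h0 => hg0 (hc.injective_jointFst
        (by rw [h0, map_zero]))) 2
  · intro hall
    refine iSup₂_le ?_
    rintro h ⟨hH, hcom, hpos⟩
    obtain ⟨g, hg⟩ := isCommon_iff.1 hcom
    obtain ⟨v, hv, hp⟩ := exists_perpTo_sub (jointFst M M') V g
    obtain ⟨v', hv', hp'⟩ := exists_perpTo_sub (jointSnd M M') V g
    obtain ⟨h1, h2, h3, h4⟩ := hval h g v v' hg hv hv' hp hp'
    rw [h1, h2, h3, h4]
    refine hall _ _ (fun h0 => ?_) hp hp' ?_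
    · rw [hinner h g v hg hv hp, h0] at hpos
      simp at hpos
    · rw [sub_sub_sub_cancel_left]; exact Submodule.sub_mem _ hv' hv

end Predictors

/-! ### Admissible sequences -/

section Projection

open GaussianModel

variable {Ω : Type*} [MeasurableSpace Ω] {P : Measure Ω}

lemma isPredictor_starProjection (W : Submodule ℝ (Lp ℝ 2 P)) [FiniteDimensional ℝ W]
    (h : Lp ℝ 2 P) : IsPredictor W h (W.starProjection h) := by
  refine isPredictor_iff.2 ⟨W.starProjection_apply_mem h, fun u hu => ?_⟩
  rw [← neg_sub, inner_neg_left, W.starProjection_inner_eq_zero h u hu, neg_zero]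

/-- The predictor is the best approximation. -/
lemma norm_predictor_sub_le {W : Submodule ℝ (Lp ℝ 2 P)} [FiniteDimensional ℝ W]
    {h f : Lp ℝ 2 P} (hf : f ∈ W) : ‖predictor W h - h‖ ≤ ‖f - h‖ := by
  have hpred := isPredictor_starProjection W h
  have h1 := (isPredictor_iff.1 hpred).2 _ (Submodule.sub_mem _ hpred.1 hf)
  rw [← hpred.predictor_eq] at h1
  have h2 := norm_sub_sq_real (predictor W h - h) (predictor W h - f)
  rw [h1, sub_sub_sub_cancel_left] at h2
  exact le_of_sq_le_sq (by nlinarith [sq_nonneg ‖predictor W h - f‖]) (norm_nonneg _)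

end Projection

section Sequences

open GaussianModel

variable {X : Type*} [MetricSpace X] [CompactSpace X] [MeasurableSpace X] [BorelSpace X]
  {ν : Measure X} [IsFiniteMeasure ν]
  {Ω : Type*} [MeasurableSpace Ω] {P : Measure Ω} [IsProbabilityMeasure P]
  {Ω' : Type*} [MeasurableSpace Ω'] {P' : Measure Ω'} [IsProbabilityMeasure P']
  {M : GaussianModel ν P} {M' : GaussianModel ν P'}

lemma finrank_map_of_injective {D E : Type*} [AddCommGroup D] [Module ℝ D] [AddCommGroup E]
    [Module ℝ E] {f : D →ₗ[ℝ] E} (hf : Function.Injective f) (V : Submodule ℝ D) :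
    Module.finrank ℝ (V.map f) = Module.finrank ℝ V :=
  (Submodule.equivMapOfInjective f hf V).finrank_eq.symm

lemma finiteDimensional_constants_sup {V : Submodule ℝ (Lp ℝ 2 P)} (hV : FiniteDimensional ℝ V) :
    FiniteDimensional ℝ (constants P ⊔ V : Submodule ℝ (Lp ℝ 2 P)) := by
  unfold constants
  infer_instance

lemma exists_norm_sub_jointFst_le {h : Lp ℝ 2 P} (hh : h ∈ M.H0) {ε : ℝ} (hε : 0 < ε) :
    ∃ g, ‖h - jointFst M M' g‖ ≤ ε := by
  have h1 := M.mem_H0_of_forall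
    (LinearMap.range (jointFst M M' : jointSpace M M' →ₗ[ℝ] Lp ℝ 2 P)).topologicalClosure
    (Submodule.isClosed_topologicalClosure _)
    (fun x => Submodule.le_topologicalClosure _ ⟨jointZ0 M M' x, rfl⟩) hh
  obtain ⟨_, ⟨g, rfl⟩, hg⟩ := Metric.mem_closure_iff.1 h1 ε hε
  exact ⟨g, by rw [← dist_eq_norm]; exact hg.le⟩

lemma Compatible.admissible_spaceOf (hc : Compatible M M') {V : ℕ → Submodule ℝ (jointSpace M M')}
    (hfd : ∀ n, FiniteDimensional ℝ (V n)) (hrank : ∀ n, Module.finrank ℝ (V n) = n)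
    (hV : Consistent (jointFst M M') V) : M.Admissible fun n => spaceOf M M' (V n) := by
  refine ⟨fun n => ⟨(V n).map (jointFst M M' : jointSpace M M' →ₗ[ℝ] Lp ℝ 2 P), ?_, ?_, ?_, rfl⟩,
    fun h hh => ?_⟩
  · rintro _ ⟨v, -, rfl⟩; exact jointFst_mem_H0 M M' v
  · have := hfd n; infer_instance
  · rw [finrank_map_of_injective hc.injective_jointFst, hrank]
  · simp only [integral_sq_eq_norm_sq]
    rw [Metric.tendsto_nhds]
    intro ε hε
    have hs : 0 < √ε / 3 := by positivity
    obtain ⟨g, hg⟩ := exists_norm_sub_jointFst_le (M' := M') (M.mem_H_iff.1 hh) hs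
    filter_upwards [hV g _ hs] with n hn
    obtain ⟨v, hv, hgv⟩ := hn
    have hmem : h - center h + jointFst M M' v ∈ spaceOf M M' (V n) :=
      mem_spaceOf.2 ⟨v, hv, by
        rw [center_add, center_sub, center_of_inner_eq_zero (inner_constOne_center h),
          center_jointFst]; abel⟩
    have : FiniteDimensional ℝ (spaceOf M M' (V n)) :=
      have := hfd n
      finiteDimensional_constants_sup inferInstance
    have h1 := norm_predictor_sub_le (h := h) hmem
    have h2 : h - center h + jointFst M M' v - h =
        -((center h - jointFst M M' g) + (jointFst M M' g - jointFst M M' v)) := by abel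
    rw [h2, norm_neg] at h1
    have h3 := norm_add_le (center h - jointFst M M' g) (jointFst M M' g - jointFst M M' v)
    rw [dist_zero_right, norm_pow, norm_norm]
    have h4 : ‖predictor (spaceOf M M' (V n)) h - h‖ < √ε := by
      have : 0 < √ε := by positivity
      linarith
    calc _ < √ε ^ 2 := pow_lt_pow_left₀ h4 (norm_nonneg _) (by norm_num)
      _ = ε := Real.sq_sqrt hε.le

lemma Compatible.exists_eq_spaceOf (hc : Compatible M M') {Hn : ℕ → Submodule ℝ (Lp ℝ 2 P)}
    (hadm : M.Admissible Hn) (hcom : ∀ n, ∀ g ∈ Hn n, IsCommon M M' g) :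
    ∃ V : ℕ → Submodule ℝ (jointSpace M M'), (∀ n, FiniteDimensional ℝ (V n)) ∧
      (∀ n, Module.finrank ℝ (V n) = n) ∧ Consistent (jointFst M M') V ∧
      ∀ n, Hn n = spaceOf M M' (V n) := by
  choose V0 hV0 hfd hrank heq using hadm.form
  let V : ℕ → Submodule ℝ (jointSpace M M') := fun n =>
    (V0 n).comap (jointFst M M' : jointSpace M M' →ₗ[ℝ] Lp ℝ 2 P)
  have hmap : ∀ n, (V n).map (jointFst M M' : jointSpace M M' →ₗ[ℝ] Lp ℝ 2 P) = V0 n := by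
    intro n
    rw [Submodule.map_comap_eq_self]
    intro u hu
    obtain ⟨g, hg⟩ := isCommon_iff.1 (hcom n u (by rw [heq]; exact Submodule.mem_sup_right hu))
    rw [M.center_of_mem_H0 (hV0 n hu)] at hg
    exact ⟨g, hg⟩
  have hV : ∀ n, Hn n = spaceOf M M' (V n) := fun n => by rw [heq, spaceOf, hmap]
  have e : ∀ n, V n ≃ₗ[ℝ] V0 n := fun n =>
    (Submodule.equivMapOfInjective _ hc.injective_jointFst (V n)).trans
      (LinearEquiv.ofEq _ _ (hmap n))
  refine ⟨V, fun n => ?_, fun n => ?_, fun g ε hε => ?_, hV⟩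
  · have := hfd n
    exact (e n).symm.finiteDimensional
  · rw [(e n).finrank_eq, hrank]
  · have h1 := hadm.consistent (jointFst M M' g)
      (by rw [mem_H_iff, center_jointFst]; exact jointFst_mem_H0 M M' g)
    simp only [integral_sq_eq_norm_sq] at h1
    filter_upwards [h1.eventually_lt_const (pow_pos hε 2)] with n hn
    have := hfd n
    have : FiniteDimensional ℝ (Hn n) := by rw [heq]; exact finiteDimensional_constants_sup (hfd n)
    have hpm : predictor (Hn n) (jointFst M M' g) ∈ Hn n := by
      have hpred := isPredictor_starProjection (Hn n) (jointFst M M' g)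
      rw [hpred.predictor_eq]; exact hpred.1
    rw [hV] at hpm
    obtain ⟨v, hv, hvp⟩ := mem_spaceOf.1 hpm
    refine ⟨v, hv, ?_⟩
    rw [norm_sq_eq, center_sub, center_jointFst, hV, ← hvp] at hn
    rw [norm_sub_rev]
    exact le_of_sq_le_sq (le_trans (le_add_of_nonneg_left (sq_nonneg _)) hn.le) hε.le

/-- Admissible sequences of common observables, as sequences of spaces of joint observables. -/
lemma uniformLimit_iff (F : Submodule ℝ (Lp ℝ 2 P) → Lp ℝ 2 P → ℝ) (l : ℝ≥0∞) :
    UniformLimit M M' F l ↔ Compatible M M' ∧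
      ∀ V : ℕ → Submodule ℝ (jointSpace M M'), (∀ n, FiniteDimensional ℝ (V n)) →
        (∀ n, Module.finrank ℝ (V n) = n) → Consistent (jointFst M M') V →
        Tendsto (fun n => ⨆ h ∈ Hminus M M' (spaceOf M M' (V n)),
          ENNReal.ofReal (F (spaceOf M M' (V n)) h)) atTop (𝓝 l) := by
  refine and_congr_right fun hc => ⟨fun h V hfd hrank hV => ?_, fun h Hn hadm hcom => ?_⟩
  · exact h _ (hc.admissible_spaceOf hfd hrank hV) fun n g hg =>
      isCommon_iff.2 (by obtain ⟨v, -, hv⟩ := mem_spaceOf.1 hg; exact ⟨v, hv⟩)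
  · obtain ⟨V, hfd, hrank, hV, heq⟩ := hc.exists_eq_spaceOf hadm hcom
    simp only [heq]
    exact h V hfd hrank hV

lemma linearIndependent_jointZ0 : LinearIndependent ℝ (jointZ0 M M') :=
  LinearIndependent.of_comp (jointFst M M' : jointSpace M M' →ₗ[ℝ] Lp ℝ 2 P) M.linearIndependent_Z0

lemma continuous_jointZ0 : Continuous (jointZ0 M M') :=
  (M.continuous_Z0.prodMk M'.continuous_Z0).subtype_mk _

lemma not_finiteDimensional_jointSpace [Infinite X] : ¬ FiniteDimensional ℝ (jointSpace M M') :=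
  fun _ => not_finite_iff_infinite.2 ‹Infinite X›
    (linearIndependent_jointZ0 (M := M) (M' := M')).finite

lemma exists_injective_denseRange (X : Type*) [MetricSpace X] [CompactSpace X] [Infinite X] :
    ∃ x : ℕ → X, Function.Injective x ∧ DenseRange x := by
  have hinf : (Set.range (TopologicalSpace.denseSeq X)).Infinite := by
    intro hfin
    have h1 := (TopologicalSpace.denseRange_denseSeq X).closure_range
    rw [hfin.isClosed.closure_eq] at h1
    rw [h1] at hfin
    exact Set.infinite_univ hfin
  have : Infinite (Set.range (TopologicalSpace.denseSeq X)) := hinf.to_subtype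
  have : Countable (Set.range (TopologicalSpace.denseSeq X)) :=
    (Set.countable_range _).to_subtype
  obtain ⟨hden⟩ := nonempty_denumerable (Set.range (TopologicalSpace.denseSeq X))
  let e := (Denumerable.eqv (Set.range (TopologicalSpace.denseSeq X))).symm
  refine ⟨fun n => e n, Subtype.val_injective.comp e.injective, ?_⟩
  have : Set.range (fun n => (e n : X)) = Set.range (TopologicalSpace.denseSeq X) := by
    rw [← Function.comp_def, Set.range_comp, e.range_eq_univ, Set.image_univ, Subtype.range_coe]
  rw [DenseRange, this]
  exact TopologicalSpace.denseRange_denseSeq X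

/-- A chain of spaces of joint observables whose union is dense. -/
lemma exists_dense_chain [Infinite X] : ∃ F : ℕ → Submodule ℝ (jointSpace M M'),
    (∀ n, FiniteDimensional ℝ (F n)) ∧ (∀ n, Module.finrank ℝ (F n) = n) ∧ Monotone F ∧
    ∀ V : ℕ → Submodule ℝ (jointSpace M M'), (∀ m, ∀ᶠ n in atTop, F m ≤ V n) →
      Consistent (jointFst M M') V := by
  obtain ⟨x, hxinj, hxd⟩ := exists_injective_denseRange X
  let F : ℕ → Submodule ℝ (jointSpace M M') := fun n =>
    Submodule.span ℝ (Set.range fun i : Fin n => jointZ0 M M' (x i))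
  have hmono : Monotone F := fun m n hmn => Submodule.span_mono (by
    rintro _ ⟨i, rfl⟩; exact ⟨Fin.castLE hmn i, rfl⟩)
  refine ⟨F, fun n => FiniteDimensional.span_of_finite ℝ (Set.finite_range _), fun n => ?_, hmono,
    fun V hV g ε hε => ?_⟩
  · have hli : LinearIndependent ℝ fun i : Fin n => jointZ0 M M' (x i) :=
      (linearIndependent_jointZ0 (M := M) (M' := M')).comp _ (hxinj.comp Fin.val_injective)
    rw [finrank_span_eq_card hli, Fintype.card_fin]
  · have htop : (⨆ n, F n).topologicalClosure = ⊤ :=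
      eq_top_of_jointZ0_mem M M' _ (Submodule.isClosed_topologicalClosure _) fun y =>
        hxd.induction_on (p := fun y => jointZ0 M M' y ∈ (⨆ n, F n).topologicalClosure) y
          ((Submodule.isClosed_topologicalClosure _).preimage continuous_jointZ0) fun n =>
          Submodule.le_topologicalClosure _ (Submodule.mem_iSup_of_mem (n + 1)
            (Submodule.subset_span ⟨Fin.last n, by simp⟩))
    have hg : g ∈ (⨆ n, F n).topologicalClosure := htop ▸ Submodule.mem_top
    obtain ⟨f, hf, hgf⟩ := Metric.mem_closure_iff.1 hg ε hε
    obtain ⟨m, hm⟩ := (Submodule.mem_iSup_of_directed _ hmono.directed_le).1 hf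
    filter_upwards [hV m] with n hn
    refine ⟨f, hn hm, ?_⟩
    rw [← map_sub]
    rw [dist_eq_norm] at hgf
    exact (norm_fst_le (g - f : jointSpace M M').1).trans hgf.le

end Sequences

/-! ### The four assertions -/

section Limits

lemma tendsto_one_iff_of_one_le {f : ℕ → ℝ≥0∞} (hf : ∀ n, 1 ≤ f n) :
    Tendsto f atTop (𝓝 1) ↔ ∀ ε : ℝ, 0 < ε → ∀ᶠ n in atTop, f n ≤ ENNReal.ofReal (1 + ε) := by
  constructor
  · intro h ε hε
    have h1 : (1 : ℝ≥0∞) < ENNReal.ofReal (1 + ε) := by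
      rw [← ENNReal.ofReal_one]
      exact (ENNReal.ofReal_lt_ofReal_iff (by linarith)).2 (by linarith)
    exact (h.eventually_lt_const h1).mono fun n hn => hn.le
  · intro h
    refine tendsto_order.2 ⟨fun b hb => Eventually.of_forall fun n => hb.trans_le (hf n),
      fun b hb => ?_⟩
    obtain ⟨r, hr0, hr1, hrb⟩ := ENNReal.lt_iff_exists_real_btwn.1 hb
    have hr : 1 < r := by
      rw [← ENNReal.ofReal_one] at hr1
      exact (ENNReal.ofReal_lt_ofReal_iff_of_nonneg zero_le_one).1 hr1
    filter_upwards [h (r - 1) (by linarith)] with n hn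
    rw [add_sub_cancel] at hn
    exact hn.trans_lt hrb

lemma tendsto_zero_iff_ofReal {f : ℕ → ℝ≥0∞} :
    Tendsto f atTop (𝓝 0) ↔ ∀ ε : ℝ, 0 < ε → ∀ᶠ n in atTop, f n ≤ ENNReal.ofReal ε := by
  constructor
  · intro h ε hε
    exact (h.eventually_lt_const (ENNReal.ofReal_pos.2 hε)).mono fun n hn => hn.le
  · intro h
    refine tendsto_order.2 ⟨fun b hb => absurd hb not_lt_zero, fun b hb => ?_⟩
    obtain ⟨r, hr0, hr1, hrb⟩ := ENNReal.lt_iff_exists_real_btwn.1 hb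
    filter_upwards [h r (ENNReal.ofReal_pos.1 hr1)] with n hn
    exact hn.trans_lt hrb

end Limits

section Assertions

open GaussianModel

variable {X : Type*} [MetricSpace X] [CompactSpace X] [MeasurableSpace X] [BorelSpace X]
  {ν : Measure X} [IsFiniteMeasure ν]
  {Ω : Type*} [MeasurableSpace Ω] {P : Measure Ω} [IsProbabilityMeasure P]
  {Ω' : Type*} [MeasurableSpace Ω'] {P' : Measure Ω'} [IsProbabilityMeasure P']
  {M : GaussianModel ν P} {M' : GaussianModel ν P'}

lemma FormEquiv.compatible (he : FormEquiv (jointFst M M') (jointSnd M M')) :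
    Compatible M M' := by
  obtain ⟨k, K, hk, hK, hkK⟩ := he
  intro h h' hh
  obtain ⟨h1, h2⟩ := hkK ⟨(h, h'), hh⟩
  change k * ‖h‖ ≤ ‖h'‖ at h1
  change ‖h'‖ ≤ K * ‖h‖ at h2
  constructor
  · rintro rfl
    simpa using h2
  · rintro rfl
    rw [norm_zero] at h1
    exact norm_le_zero_iff.1 (nonpos_of_mul_nonpos_right h1 hk)

lemma FormEquiv.isCommon (he : FormEquiv (jointFst M M') (jointSnd M M')) {h : Lp ℝ 2 P}
    (hh : h ∈ M.H) : IsCommon M M' h :=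
  isCommon_iff.2 (exists_jointFst_eq he (M.mem_H_iff.1 hh))

variable (M M') in
/-- `Q (V n)` holds eventually along every admissible sequence `V`. -/
def EventuallyAdmissible (Q : Submodule ℝ (jointSpace M M') → Prop) : Prop :=
  ∀ V : ℕ → Submodule ℝ (jointSpace M M'), (∀ n, FiniteDimensional ℝ (V n)) →
    (∀ n, Module.finrank ℝ (V n) = n) → Consistent (jointFst M M') V → ∀ᶠ n in atTop, Q (V n)

lemma assertion1_iff [Infinite X] : Assertion1 M M' ↔ Compatible M M' ∧
    ∀ ε : ℝ, 0 < ε → EventuallyAdmissible M M' (RatioLe (jointFst M M') (jointSnd M M') ε) := by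
  rw [Assertion1, uniformLimit_iff]
  refine and_congr_right fun hc => ?_
  have hp := hc.injective_jointFst
  have hp' := hc.injective_jointSnd
  have hle : ∀ (V : Submodule ℝ (jointSpace M M')) [FiniteDimensional ℝ V] (x : ℝ≥0∞), _ :=
    fun V _ x => hc.iSup_Hminus_le_iff V (fun a b _ _ => b / a) x
  have hratio : ∀ (V : Submodule ℝ (jointSpace M M')) (hV : FiniteDimensional ℝ V) (ε : ℝ),
      0 < ε → ((⨆ h ∈ Hminus M M' (spaceOf M M' V), ENNReal.ofReal
        (Var[predictor' M M' (spaceOf M M' V) h - h; P] /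
          Var[predictor (spaceOf M M' V) h - h; P])) ≤ ENNReal.ofReal (1 + ε) ↔
        RatioLe (jointFst M M') (jointSnd M M') ε V) := by
    intro V hV ε hε
    rw [hle V]
    constructor
    · intro h g g' hg hg' hgg
      rcases eq_or_ne g 0 with rfl | hg0
      · rw [zero_sub, Submodule.neg_mem_iff] at hgg
        rw [hg'.eq_zero_of_mem hp' hgg]; simp
      · have := h g g' hg0 hg hg' hgg
        rwa [ENNReal.ofReal_le_ofReal_iff (by linarith),
          div_le_iff₀ (norm_sq_pos_of_ne_zero hp hg0)] at this
    · intro h g g' hg0 hg hg' hgg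
      rw [ENNReal.ofReal_le_ofReal_iff (by linarith),
          div_le_iff₀ (norm_sq_pos_of_ne_zero hp hg0)]
      exact h g g' hg hg' hgg
  have hone : ∀ (V : Submodule ℝ (jointSpace M M')) (hV : FiniteDimensional ℝ V),
      1 ≤ ⨆ h ∈ Hminus M M' (spaceOf M M' V), ENNReal.ofReal
        (Var[predictor' M M' (spaceOf M M' V) h - h; P] /
          Var[predictor (spaceOf M M' V) h - h; P]) := by
    intro V hV
    obtain ⟨g, hg0, hg⟩ := exists_perpTo_ne_zero (jointFst M M')
      not_finiteDimensional_jointSpace V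
    obtain ⟨v, hv, hg'⟩ := exists_perpTo_sub (jointSnd M M') V g
    have hgg : g - (g - v) ∈ V := by rwa [sub_sub_cancel]
    refine le_trans ?_ ((hle V _).1 le_rfl g (g - v) hg0 hg hg' hgg)
    rw [← ENNReal.ofReal_one]
    refine ENNReal.ofReal_le_ofReal ?_
    rw [one_le_div (norm_sq_pos_of_ne_zero hp hg0), norm_sq_eq_of_sub_mem hg hgg]
    linarith [sq_nonneg ‖jointFst M M' (g - (g - v))‖]
  constructor
  · intro h ε hε V hfd hrank hV
    filter_upwards [(tendsto_one_iff_of_one_le fun n => hone _ (hfd n)).1 (h V hfd hrank hV) ε hε]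
      with n hn
    exact (hratio _ (hfd n) ε hε).1 hn
  · intro h V hfd hrank hV
    refine (tendsto_one_iff_of_one_le fun n => hone _ (hfd n)).2 fun ε hε => ?_
    filter_upwards [h ε hε V hfd hrank hV] with n hn
    exact (hratio _ (hfd n) ε hε).2 hn

lemma assertion2_iff [Infinite X] : Assertion2 M M' ↔ Compatible M M' ∧
    ∀ ε : ℝ, 0 < ε → EventuallyAdmissible M M' (RatioLe (jointSnd M M') (jointFst M M') ε) := by
  rw [Assertion2, uniformLimit_iff]
  refine and_congr_right fun hc => ?_
  have hp := hc.injective_jointFst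
  have hp' := hc.injective_jointSnd
  have hle : ∀ (V : Submodule ℝ (jointSpace M M')) [FiniteDimensional ℝ V] (x : ℝ≥0∞), _ :=
    fun V _ x => hc.iSup_Hminus_le_iff V (fun _ _ c d => c / d) x
  have hratio : ∀ (V : Submodule ℝ (jointSpace M M')) (hV : FiniteDimensional ℝ V) (ε : ℝ),
      0 < ε → ((⨆ h ∈ Hminus M M' (spaceOf M M' V), ENNReal.ofReal
        (var' M M' (predictor (spaceOf M M' V) h - h) /
          var' M M' (predictor' M M' (spaceOf M M' V) h - h))) ≤ ENNReal.ofReal (1 + ε) ↔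
        RatioLe (jointSnd M M') (jointFst M M') ε V) := by
    intro V hV ε hε
    rw [hle V]
    constructor
    · intro h g' g hg' hg hgg
      have hgg' : g - g' ∈ V := by rw [← neg_sub]; exact Submodule.neg_mem _ hgg
      rcases eq_or_ne g 0 with rfl | hg0
      · rw [map_zero, norm_zero, zero_pow two_ne_zero]; positivity
      · have := h g g' hg0 hg hg' hgg'
        rwa [ENNReal.ofReal_le_ofReal_iff (by linarith),
          div_le_iff₀ (norm_sq_pos_of_ne_zero hp' (hg.ne_zero_of_sub_mem hp hgg' hg0))] at this
    · intro h g g' hg0 hg hg' hgg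
      rw [ENNReal.ofReal_le_ofReal_iff (by linarith),
          div_le_iff₀ (norm_sq_pos_of_ne_zero hp' (hg.ne_zero_of_sub_mem hp hgg hg0))]
      exact h g' g hg' hg (by rw [← neg_sub]; exact Submodule.neg_mem _ hgg)
  have hone : ∀ (V : Submodule ℝ (jointSpace M M')) (hV : FiniteDimensional ℝ V),
      1 ≤ ⨆ h ∈ Hminus M M' (spaceOf M M' V), ENNReal.ofReal
        (var' M M' (predictor (spaceOf M M' V) h - h) /
          var' M M' (predictor' M M' (spaceOf M M' V) h - h)) := by
    intro V hV
    obtain ⟨g, hg0, hg⟩ := exists_perpTo_ne_zero (jointFst M M')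
      not_finiteDimensional_jointSpace V
    obtain ⟨v, hv, hg'⟩ := exists_perpTo_sub (jointSnd M M') V g
    have hgg : g - (g - v) ∈ V := by rwa [sub_sub_cancel]
    refine le_trans ?_ ((hle V _).1 le_rfl g (g - v) hg0 hg hg' hgg)
    rw [← ENNReal.ofReal_one]
    refine ENNReal.ofReal_le_ofReal ?_
    rw [one_le_div (norm_sq_pos_of_ne_zero hp' (hg.ne_zero_of_sub_mem hp hgg hg0)),
      norm_sq_eq_of_sub_mem (g' := g) hg'
        (by rw [sub_sub_cancel_left]; exact Submodule.neg_mem _ hv)]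
    linarith [sq_nonneg ‖jointSnd M M' (g - v - g)‖]
  constructor
  · intro h ε hε V hfd hrank hV
    filter_upwards [(tendsto_one_iff_of_one_le fun n => hone _ (hfd n)).1 (h V hfd hrank hV) ε hε]
      with n hn
    exact (hratio _ (hfd n) ε hε).1 hn
  · intro h V hfd hrank hV
    refine (tendsto_one_iff_of_one_le fun n => hone _ (hfd n)).2 fun ε hε => ?_
    filter_upwards [h ε hε V hfd hrank hV] with n hn
    exact (hratio _ (hfd n) ε hε).2 hn

lemma abs_div_sub_le_iff {x y a ε : ℝ} (hy : 0 < y) : |x / y - a| ≤ ε ↔ |x - a * y| ≤ ε * y := by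
  have : x / y - a = (x - a * y) / y := by field_simp
  rw [this, abs_div, abs_of_pos hy, div_le_iff₀ hy]

lemma assertion3_iff (a : ℝ) : Assertion3 M M' a ↔ Compatible M M' ∧
    ∀ ε : ℝ, 0 < ε → EventuallyAdmissible M M' (DiffLe (jointFst M M') (jointSnd M M') a ε) := by
  rw [Assertion3, uniformLimit_iff]
  refine and_congr_right fun hc => ?_
  have hp := hc.injective_jointFst
  have hratio : ∀ (V : Submodule ℝ (jointSpace M M')) (hV : FiniteDimensional ℝ V) (ε : ℝ),
      0 < ε → ((⨆ h ∈ Hminus M M' (spaceOf M M' V), ENNReal.ofReal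
        |var' M M' (predictor (spaceOf M M' V) h - h) /
          Var[predictor (spaceOf M M' V) h - h; P] - a|) ≤ ENNReal.ofReal ε ↔
        DiffLe (jointFst M M') (jointSnd M M') a ε V) := by
    intro V hV ε hε
    rw [hc.iSup_Hminus_le_iff V (fun x _ y _ => |y / x - a|)]
    constructor
    · intro h g hg
      rcases eq_or_ne g 0 with rfl | hg0
      · simp
      obtain ⟨v, hv, hg'⟩ := exists_perpTo_sub (jointSnd M M') V g
      have := h g (g - v) hg0 hg hg' (by rwa [sub_sub_cancel])
      rwa [ENNReal.ofReal_le_ofReal_iff hε.le,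
        abs_div_sub_le_iff (norm_sq_pos_of_ne_zero hp hg0)] at this
    · intro h g g' hg0 hg hg' hgg
      rw [ENNReal.ofReal_le_ofReal_iff hε.le,
        abs_div_sub_le_iff (norm_sq_pos_of_ne_zero hp hg0)]
      exact h g hg
  simp only [tendsto_zero_iff_ofReal]
  constructor
  · intro h ε hε V hfd hrank hV
    filter_upwards [h V hfd hrank hV ε hε] with n hn
    exact (hratio _ (hfd n) ε hε).1 hn
  · intro h V hfd hrank hV ε hε
    filter_upwards [h ε hε V hfd hrank hV] with n hn
    exact (hratio _ (hfd n) ε hε).2 hn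

lemma assertion4_iff (a : ℝ) : Assertion4 M M' a ↔ Compatible M M' ∧
    ∀ ε : ℝ, 0 < ε →
      EventuallyAdmissible M M' (DiffLe (jointSnd M M') (jointFst M M') a⁻¹ ε) := by
  rw [Assertion4, uniformLimit_iff]
  refine and_congr_right fun hc => ?_
  have hp := hc.injective_jointFst
  have hp' := hc.injective_jointSnd
  have hratio : ∀ (V : Submodule ℝ (jointSpace M M')) (hV : FiniteDimensional ℝ V) (ε : ℝ),
      0 < ε → ((⨆ h ∈ Hminus M M' (spaceOf M M' V), ENNReal.ofReal
        |Var[predictor' M M' (spaceOf M M' V) h - h; P] /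
          var' M M' (predictor' M M' (spaceOf M M' V) h - h) - 1 / a|) ≤ ENNReal.ofReal ε ↔
        DiffLe (jointSnd M M') (jointFst M M') a⁻¹ ε V) := by
    intro V hV ε hε
    rw [hc.iSup_Hminus_le_iff V (fun _ x _ y => |x / y - 1 / a|), one_div]
    constructor
    · intro h g' hg'
      rcases eq_or_ne g' 0 with rfl | hg0'
      · simp
      obtain ⟨v, hv, hg⟩ := exists_perpTo_sub (jointFst M M') V g'
      have hgg : g' - v - g' ∈ V := by rw [sub_sub_cancel_left]; exact Submodule.neg_mem _ hv
      have := h (g' - v) g'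
        (hg'.ne_zero_of_sub_mem hp' (by rwa [sub_sub_cancel]) hg0') hg hg' hgg
      rwa [ENNReal.ofReal_le_ofReal_iff hε.le,
        abs_div_sub_le_iff (norm_sq_pos_of_ne_zero hp' hg0')] at this
    · intro h g g' hg0 hg hg' hgg
      rw [ENNReal.ofReal_le_ofReal_iff hε.le,
        abs_div_sub_le_iff (norm_sq_pos_of_ne_zero hp' (hg.ne_zero_of_sub_mem hp hgg hg0))]
      exact h g' hg'
  simp only [tendsto_zero_iff_ofReal]
  constructor
  · intro h ε hε V hfd hrank hV
    filter_upwards [h V hfd hrank hV ε hε] with n hn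
    exact (hratio _ (hfd n) ε hε).1 hn
  · intro h V hfd hrank hV ε hε
    filter_upwards [h ε hε V hfd hrank hV] with n hn
    exact (hratio _ (hfd n) ε hε).2 hn

/-- An assertion on ratios of variances within one model implies equivalence and compactness. -/
lemma formApprox_of_eventually_ratioLe [Infinite X] {E E' : Type*} [NormedAddCommGroup E]
    [InnerProductSpace ℝ E] [CompleteSpace E] [NormedAddCommGroup E'] [InnerProductSpace ℝ E']
    [CompleteSpace E'] {p : jointSpace M M' →L[ℝ] E} {p' : jointSpace M M' →L[ℝ] E'}
    (hgraph : ∀ g, ‖g‖ ≤ ‖p' g‖ + ‖p g‖) (hp : Function.Injective p) (hp' : Function.Injective p')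
    (h : ∀ ε : ℝ, 0 < ε → EventuallyAdmissible M M' (RatioLe p p' ε)) :
    FormEquiv p' p ∧ ∃ a, 0 < a ∧ FormApprox p' p a := by
  obtain ⟨F, hfd, hrank, hmono, hF⟩ := exists_dense_chain (M := M) (M' := M')
  refine formEquiv_and_formApprox_of_abs_inner_le hgraph hp' hp not_finiteDimensional_jointSpace
    fun δ hδ => ?_
  obtain ⟨m, hm⟩ := exists_forall_ge_of_forall_seq hfd hrank hmono (RatioLe p p' (δ ^ 2))
    fun V hVfd hVrank hV => h _ (by positivity) V hVfd hVrank (hF V hV)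
  exact ⟨F m, hfd m, fun V hV hle g hg v hv => (hm V hV hle).abs_inner_le hδ.le hg hv⟩

lemma formApprox_of_eventually_diffLe [Infinite X] {E E' : Type*} [NormedAddCommGroup E]
    [InnerProductSpace ℝ E] [NormedAddCommGroup E'] [InnerProductSpace ℝ E']
    {p : jointSpace M M' →L[ℝ] E} {p' : jointSpace M M' →L[ℝ] E'} {a : ℝ}
    (h : ∀ ε : ℝ, 0 < ε → EventuallyAdmissible M M' (DiffLe p p' a ε)) : FormApprox p p' a := by
  obtain ⟨F, hfd, hrank, hmono, hF⟩ := exists_dense_chain (M := M) (M' := M')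
  intro ε hε
  have hev := h ε hε F hfd hrank (hF F fun m => by
    filter_upwards [eventually_ge_atTop m] with n hn using hmono hn)
  obtain ⟨n, hn⟩ := hev.exists
  exact ⟨F n, hfd n, hn⟩

end Assertions

end Kriging

open Kriging in
theorem mainTheorem2
    {X : Type*} [MetricSpace X] [CompactSpace X] [ConnectedSpace X] [Infinite X]
    [MeasurableSpace X] [BorelSpace X]
    (ν : Measure X) [IsFiniteMeasure ν] [ν.IsOpenPosMeasure]
    {Ω : Type*} [MeasurableSpace Ω] (P : Measure Ω) [IsProbabilityMeasure P]
    {Ω' : Type*} [MeasurableSpace Ω'] (P' : Measure Ω') [IsProbabilityMeasure P']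
    (M : Kriging.GaussianModel ν P) (M' : Kriging.GaussianModel ν P') :
    (Kriging.AssumptionI M M' →
      Kriging.Compatible M M' ∧ ∀ h ∈ M.H, Kriging.IsCommon M M' h) ∧
    (Kriging.Assertion1 M M' ↔
      Kriging.AssumptionI M M' ∧ ∃ a : ℝ, Kriging.AssumptionIII M M' a) ∧
    (Kriging.Assertion2 M M' ↔
      Kriging.AssumptionI M M' ∧ ∃ a : ℝ, Kriging.AssumptionIII M M' a) ∧
    (∀ a : ℝ, 0 < a → (Kriging.Assertion3 M M' a ↔
      Kriging.AssumptionI M M' ∧ Kriging.AssumptionIII M M' a)) ∧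
    (∀ a : ℝ, 0 < a → (Kriging.Assertion4 M M' a ↔
      Kriging.AssumptionI M M' ∧ Kriging.AssumptionIII M M' a)) := by
  have hg := norm_le_jointFst_add_jointSnd M M'
  have hg' := norm_le_jointSnd_add_jointFst M M'
  have hsymm : ∀ {a : ℝ}, 0 < a → FormEquiv (jointSnd M M') (jointFst M M') →
      FormApprox (jointSnd M M') (jointFst M M') a →
      FormApprox (jointFst M M') (jointSnd M M') a⁻¹ := fun ha he h => h.symm hg' he ha
  rw [assumptionI_iff]
  refine ⟨fun he => ⟨he.compatible, fun h hh => he.isCommon hh⟩, ?_, ?_, fun a ha => ?_,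
    fun a ha => ?_⟩
  · rw [assertion1_iff]
    constructor
    · rintro ⟨hc, h⟩
      obtain ⟨he, a, ha, happ⟩ := formApprox_of_eventually_ratioLe hg' hc.injective_jointFst
        hc.injective_jointSnd h
      exact ⟨he.symm, a⁻¹, (assumptionIII_iff he.symm _).2 ⟨inv_pos.2 ha, hsymm ha he happ⟩⟩
    · rintro ⟨he, a, hIII⟩
      obtain ⟨ha, happ⟩ := (assumptionIII_iff he a).1 hIII
      exact ⟨he.compatible, fun ε hε V _ _ hV =>
        (happ.symm hg he ha).eventually_ratioLe hg' he.symm (hV.of_formEquiv he) hε⟩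
  · rw [assertion2_iff]
    constructor
    · rintro ⟨hc, h⟩
      obtain ⟨he, a, ha, happ⟩ := formApprox_of_eventually_ratioLe hg hc.injective_jointSnd
        hc.injective_jointFst h
      exact ⟨he, a, (assumptionIII_iff he a).2 ⟨ha, happ⟩⟩
    · rintro ⟨he, a, hIII⟩
      obtain ⟨ha, happ⟩ := (assumptionIII_iff he a).1 hIII
      exact ⟨he.compatible, fun ε hε V _ _ hV => happ.eventually_ratioLe hg he hV hε⟩
  · rw [assertion3_iff]
    constructor
    · rintro ⟨hc, h⟩
      have happ := formApprox_of_eventually_diffLe h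
      have he := happ.formEquiv hg hc.injective_jointFst hc.injective_jointSnd ha
      exact ⟨he, (assumptionIII_iff he a).2 ⟨ha, happ⟩⟩
    · rintro ⟨he, hIII⟩
      obtain ⟨-, happ⟩ := (assumptionIII_iff he a).1 hIII
      exact ⟨he.compatible, fun ε hε V _ _ hV => happ.eventually_diffLe hg he hV hε⟩
  · rw [assertion4_iff]
    constructor
    · rintro ⟨hc, h⟩
      have happ := formApprox_of_eventually_diffLe h
      have he := happ.formEquiv hg' hc.injective_jointSnd hc.injective_jointFst
        (inv_pos.2 ha)
      have happ' := hsymm (inv_pos.2 ha) he happ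
      rw [inv_inv] at happ'
      exact ⟨he.symm, (assumptionIII_iff he.symm a).2 ⟨ha, happ'⟩⟩
    · rintro ⟨he, hIII⟩
      obtain ⟨-, happ⟩ := (assumptionIII_iff he a).1 hIII
      exact ⟨he.compatible, fun ε hε V _ _ hV =>
        (happ.symm hg he ha).eventually_diffLe hg' he.symm (hV.of_formEquiv he) hε⟩
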